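/- **Setting.** Let $d\ge 0$, $m\ge 1$ be integers, $\theta\in(0,\pi/2)$, $r>0$, $c>0$, and put $C(\theta)=\dfrac{16(1+\sin\theta)^2m^2}{3\sin^2\theta}$. Let $\varphi:[0,\infty)\to[0,\infty)$ be a bounded weight profile with $\varphi(s)=0$ for $s>1$ and $\inf_{[0,\rho]}\varphi>0$ for every $0\le\rho<\tfrac12$. (For continuous $\varphi\ge 0$ vanishing on $(1,\infty)$ this just says that $\varphi>0$ on $[0,\tfrac12)$.) Let $\alpha\in\mathbb N_0^d$ be a multi-index with $|\alpha|\le m+1$. Let $\Omega\subset\mathbb R^d$ be a compact set which satisfies the interior cone condition with angle $\theta$ and radius $r$: for every $x\in\Omega$ there is a unit vector $\xi$ with $\{x+ty:\ \|y\|=1,\ y\cdot\xi\ge\cos\theta,\ 0\le t\le r\}\subset\Omega$. Let $\Omega_h\subset\mathbb R^d$ be a finite point cloud (not necessarily contained in $\Omega$), $x_i\in\Omega_h\cap\Omega$, $\varepsilon>0$, and let $$M_i=\Big\{x_{ij}=\tfrac{x_i+x_j}{2}\ :\ x_j\in\Omega_h,\ x_j\ne x_i,\ \|x_j-x_i\|<\varepsilon\Big\}$$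 be the set of edge midpoints. Assume that $M_i$ is nonempty and contained in $\Omega$, and let $$h=\sup_{x\in\Omega}\min_{y\in M_i}\|x-y\|,\qquad q=\tfrac12\min_{y\neq z\in M_i}\|y-z\|$$ be its fill distance in $\Omega$ and its separation distance ($q:=0$ if $M_i$ is a single point). Assume that $M_i$ is quasi-uniform, $q\le h\le c\,q$, and that $h\le r/C(\theta)$. Put $$\delta=2C(\theta)h,\qquad \Phi(s)=\varphi(s/\delta),\qquad \Omega^*=\overline{B(x_i,\delta)}.$$ Let $P_m^i$ be the space of real polynomials on $\mathbb R^d$ of degree at most $m$ that vanish at $x_i$. For a function $u$ consider the weighted least-squares problem $$p^*=\operatorname*{arg\,min}_{p\in P_m^i}\ \tfrac12\sum_{x_{ij}\in M_i}\big(u(x_{ij})-p(x_{ij})\big)^2\,\Phi(\|x_i-x_{ij}\|).$$ The specialized GMLS derivative of $u$ at $x_i$ is $\widetilde D^\alpha u(x_i):=D^\alpha p^*(x_i)$; equivalently, if $p^*=\sum_k b_kp_k$ in a basis $(p_k)$ of $P_m^i$, it is $\sum_k b_k D^\alpha p_k(x_i)$. **Lemma.** There is a constant $C>0$, depending only on $d,m,\theta,r,c,\varphi,\alpha$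 (and not on $\Omega$, $\Omega_h$, $x_i$, $\varepsilon$, $h$ or $u$), such that in the above setting, for every $u:\mathbb R^d\to\mathbb R$ that is $C^{m+1}$ on $\Omega^*$ and satisfies $u(x_i)=0$, the least-squares problem has exactly one solution $p^*$, and $$\big|\widetilde D^\alpha u(x_i)-D^\alpha u(x_i)\big|\ \le\ C\,h^{\,m+1-|\alpha|}\,\|u\|_{C^{m+1}(\Omega^*)},\qquad \|u\|_{C^{m+1}(\Omega^*)}=\max_{|\beta|\le m+1}\ \sup_{x\in\Omega^*}|D^\beta u(x)|.$$ -/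

import Mathlib

namespace GMLS

/-- Points of `ℝ^d` with the Euclidean norm. -/
abbrev Pt (d : ℕ) : Type := EuclideanSpace ℝ (Fin d)

/-! ### Partial derivatives and the norm of `C^k` -/

/-- The directions of differentiation in `D^α`: the index `i` is listed `α i` times. This list
has length `|α| = ∑ i, α i`. -/
def dirs {d : ℕ} (α : Fin d → ℕ) : List (Fin d) :=
  (List.finRange d).flatMap fun i => List.replicate (α i) i

/-- The partial derivative `D^α f (x)` of a function on `ℝ^d`. -/
noncomputable def partialD {d : ℕ} (α : Fin d → ℕ) (f : Pt d → ℝ) (x : Pt d) : ℝ :=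
  iteratedFDeriv ℝ (dirs α).length f x
    fun k => EuclideanSpace.single ((dirs α).get k) (1 : ℝ)

/-- The partial derivative `D^α f (x)` of a function on a set `S ⊆ ℝ^d`, up to the boundary. -/
noncomputable def partialDWithin {d : ℕ} (α : Fin d → ℕ) (f : Pt d → ℝ) (S : Set (Pt d))
    (x : Pt d) : ℝ :=
  iteratedFDerivWithin ℝ (dirs α).length f S x
    fun k => EuclideanSpace.single ((dirs α).get k) (1 : ℝ)

/-- `‖f‖_{C^k(S)} = max_{|β| ≤ k} sup_{x ∈ S} |D^β f (x)|`. For compact `S` with unique derivatives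
(such as a closed ball) and `f ∈ C^k(S)` the supremum is over a bounded set. -/
noncomputable def cNorm {d : ℕ} (k : ℕ) (S : Set (Pt d)) (f : Pt d → ℝ) : ℝ :=
  ⨆ z : {β : Fin d → ℕ // ∑ i, β i ≤ k} × S, |partialDWithin z.1.1 f S z.2|

/-! ### Regions and point sets -/

/-- The cone with apex `x`, axis `ξ`, angle `θ` and radius `r`. -/
def cone {d : ℕ} (x ξ : Pt d) (θ r : ℝ) : Set (Pt d) :=
  {z | ∃ (t : ℝ) (y : Pt d), 0 ≤ t ∧ t ≤ r ∧ ‖y‖ = 1 ∧ Real.cos θ ≤ inner ℝ y ξ ∧ z = x + t • y}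

/-- Interior cone condition with radius `r` and angle `θ`. -/
def InteriorConeCondition {d : ℕ} (Ω : Set (Pt d)) (θ r : ℝ) : Prop :=
  ∀ x ∈ Ω, ∃ ξ : Pt d, ‖ξ‖ = 1 ∧ cone x ξ θ r ⊆ Ω

/-- The fill distance `h_{X,Ω} = sup_{x ∈ Ω} min_{y ∈ X} ‖x - y‖` (for nonempty `X` and
bounded `Ω`). -/
noncomputable def fillDist {d : ℕ} (X : Finset (Pt d)) (Ω : Set (Pt d)) : ℝ :=
  sSup ((fun x => Metric.infDist x (X : Set (Pt d))) '' Ω)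

/-- The separation distance `q_X = (1/2) min_{x ≠ y ∈ X} ‖x - y‖` (for `X` with at least two
points). -/
noncomputable def sepDist {d : ℕ} (X : Finset (Pt d)) : ℝ :=
  (1 / 2) * sInf {s : ℝ | ∃ x ∈ X, ∃ y ∈ X, x ≠ y ∧ s = ‖x - y‖}

/-- `X` is quasi-uniform in `Ω` with constant `c`. -/
def QuasiUniform {d : ℕ} (c : ℝ) (X : Finset (Pt d)) (Ω : Set (Pt d)) : Prop :=
  sepDist X ≤ fillDist X Ω ∧ fillDist X Ω ≤ c * sepDist X

/-- `C(θ) = 16 (1 + sin θ)² m² / (3 sin² θ)`. -/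
noncomputable def coneConst (m : ℕ) (θ : ℝ) : ℝ :=
  16 * (1 + Real.sin θ) ^ 2 * (m : ℝ) ^ 2 / (3 * Real.sin θ ^ 2)

open Classical in
/-- The midpoints `(x + y) / 2` of the edges joining `x` to the other points `y` of its
`ε`-neighborhood in the point cloud `Ωh`. -/
noncomputable def midpoints {d : ℕ} (Ωh : Finset (Pt d)) (x : Pt d) (ε : ℝ) : Finset (Pt d) :=
  (Ωh.filter fun y => y ≠ x ∧ ‖y - x‖ < ε).image fun y => midpoint ℝ x y

/-! ### Weights -/

/-- Profile `φ` of the radial weights `Φ(s) = φ(s / δ)`: it is nonnegative, vanishes for `s > 1`,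
is bounded, and on `[0, 1/2)` it is positive, locally bounded away from `0` (for a continuous `φ`
that vanishes for `s > 1`, the last two conditions say exactly that `φ > 0` on `[0, 1/2)`). -/
structure IsWeightProfile (φ : ℝ → ℝ) : Prop where
  nonneg : ∀ s, 0 ≤ s → 0 ≤ φ s
  support : ∀ s, 1 < s → φ s = 0
  bounded : ∃ K, ∀ s, 0 ≤ s → φ s ≤ K
  pos : ∀ ρ, ρ < 1 / 2 → ∃ κ, 0 < κ ∧ ∀ s, 0 ≤ s → s ≤ ρ → κ ≤ φ s

/-! ### The specialized GMLS derivative -/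

/-- The function on `ℝ^d` given by a polynomial. -/
noncomputable def polyFun {d : ℕ} (p : MvPolynomial (Fin d) ℝ) (x : Pt d) : ℝ :=
  MvPolynomial.eval (fun i => x i) p

/-- The polynomials of degree at most `m` that vanish at `x`. -/
def polySpace {d : ℕ} (m : ℕ) (x : Pt d) : Set (MvPolynomial (Fin d) ℝ) :=
  {p | p.totalDegree ≤ m ∧ polyFun p x = 0}

/-- The weighted least-squares functional
`(1/2) ∑_{y ∈ M} (u(y) - p(y))² Φ(‖x - y‖)`. -/
noncomputable def lsq {d : ℕ} (Φ : ℝ → ℝ) (x : Pt d) (M : Finset (Pt d)) (u : Pt d → ℝ)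
    (p : MvPolynomial (Fin d) ℝ) : ℝ :=
  (1 / 2) * ∑ y ∈ M, (u y - polyFun p y) ^ 2 * Φ ‖x - y‖

/-- `p` is a best weighted least-squares fit to `u` on `M` out of `polySpace m x`. -/
def IsFit {d : ℕ} (m : ℕ) (Φ : ℝ → ℝ) (x : Pt d) (M : Finset (Pt d)) (u : Pt d → ℝ)
    (p : MvPolynomial (Fin d) ℝ) : Prop :=
  p ∈ polySpace m x ∧ ∀ q ∈ polySpace m x, lsq Φ x M u p ≤ lsq Φ x M u q

open Classical in
/-- The GMLS derivative at `x`: for the best fit `p = ∑ b_k p_k` (in any basis `p_k` of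
`polySpace m x`) it is `∑ b_k D^α p_k (x) = D^α p (x)`. The default `0` is only used
when there is no best fit. -/
noncomputable def gmlsDeriv {d : ℕ} (m : ℕ) (Φ : ℝ → ℝ) (x : Pt d) (M : Finset (Pt d))
    (α : Fin d → ℕ) (u : Pt d → ℝ) : ℝ :=
  if h : ∃ p, IsFit m Φ x M u p then partialD α (polyFun h.choose) x else 0

end GMLS

namespace GMLS

open MvPolynomial


/-! Since `u x = 0`, the Taylor polynomial `t` of degree `m` at `x` competes with the best fit `p`.
Optimality bounds the weighted sum of squares of `p - t` on `M` by four times that of `u - t`.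
Quasi-uniformity leaves boundedly many midpoints within `δ`, the weights are bounded, and `u - t` is
of order `h ^ (m + 1)` there, so the whole sum is of order `h ^ (2 * (m + 1))`.

To return from the sum to `p - t` itself, the cone at `x` supplies a ball of radius `s = 10 m² h`
inside `Ω` on which the weight is at least `κ` (`exists_ball_near`). There the midpoints form a
norming set (`norming_on_ball`): from a point where a polynomial attains its maximum modulus, some
midpoint is seen along a ray that stays in the ball for `1 + 3 m²` times the distance, and Markov's
inequality limits the variation up to that midpoint to 2/3 of the maximum. So `p - t` is of order `h
^ (m + 1)` on the ball, and the same norming property gives uniqueness of the fit.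

Equivalence of norms on polynomials of bounded degree, rescaled to radius `s`, turns this into a
bound on the derivative at `x` and costs the factor `s ^ |α|` (`exists_partialD_bound`). As `t` and
`u` have the same derivatives at `x` up to order `m`, this is the claim for `|α| ≤ m`; for `|α| = m
+ 1` the derivative of `p` vanishes. -/

/-! ### Polynomial functions, their derivatives and scaling -/

theorem contDiff_polyFun {d : ℕ} (p : MvPolynomial (Fin d) ℝ) {n : WithTop ℕ∞} :
    ContDiff ℝ n (polyFun p) := by
  induction p using MvPolynomial.induction_on with
  | C a =>
    have : polyFun (C a) = fun _ : Pt d => a := by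
      funext x; simp [polyFun]
    rw [this]; exact contDiff_const
  | add p q hp hq =>
    have : polyFun (p + q) = fun x => polyFun p x + polyFun q x := by
      funext x; simp [polyFun]
    rw [this]; exact hp.add hq
  | mul_X p i hp =>
    have : polyFun (p * X i) = fun x => polyFun p x * x i := by
      funext x; simp [polyFun]
    rw [this]
    exact hp.mul (by fun_prop)

theorem polyFun_add {d : ℕ} (p q : MvPolynomial (Fin d) ℝ) (x : Pt d) :
    polyFun (p + q) x = polyFun p x + polyFun q x := by simp [polyFun]

theorem polyFun_sub {d : ℕ} (p q : MvPolynomial (Fin d) ℝ) (x : Pt d) :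
    polyFun (p - q) x = polyFun p x - polyFun q x := by simp [polyFun]

theorem polyFun_smul {d : ℕ} (a : ℝ) (p : MvPolynomial (Fin d) ℝ) (x : Pt d) :
    polyFun (a • p) x = a * polyFun p x := by simp [polyFun, smul_eval]

theorem partialD_polyFun_add {d : ℕ} (α : Fin d → ℕ) (p q : MvPolynomial (Fin d) ℝ) (x : Pt d) :
    partialD α (polyFun (p + q)) x = partialD α (polyFun p) x + partialD α (polyFun q) x := by
  have h : polyFun (p + q) = polyFun p + polyFun q := by
    funext y; exact polyFun_add p q y
  rw [partialD, h, iteratedFDeriv_add_apply (contDiff_polyFun p).contDiffAt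
    (contDiff_polyFun q).contDiffAt]
  rfl

theorem partialD_polyFun_smul {d : ℕ} (α : Fin d → ℕ) (a : ℝ) (p : MvPolynomial (Fin d) ℝ)
    (x : Pt d) : partialD α (polyFun (a • p)) x = a * partialD α (polyFun p) x := by
  have h : polyFun (a • p) = a • polyFun p := by
    funext y; exact polyFun_smul a p y
  rw [partialD, h, iteratedFDeriv_const_smul_apply (contDiff_polyFun p).contDiffAt]
  rfl

theorem partialD_polyFun_sub {d : ℕ} (α : Fin d → ℕ) (p q : MvPolynomial (Fin d) ℝ) (x : Pt d) :
    partialD α (polyFun (p - q)) x = partialD α (polyFun p) x - partialD α (polyFun q) x := by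
  have h := partialD_polyFun_add α (p - q) q x
  rw [sub_add_cancel] at h
  linarith

theorem continuous_partialD_polyFun {d : ℕ} (α : Fin d → ℕ) (p : MvPolynomial (Fin d) ℝ) :
    Continuous (partialD α (polyFun p)) := by
  have h : Continuous (iteratedFDeriv ℝ (dirs α).length (polyFun p)) :=
    (contDiff_polyFun p (n := ⊤)).continuous_iteratedFDeriv (by exact_mod_cast le_top)
  exact (ContinuousMultilinearMap.apply ℝ (fun _ : Fin (dirs α).length => Pt d) ℝ _).continuous.comp h

theorem length_dirs {d : ℕ} (α : Fin d → ℕ) : (dirs α).length = ∑ i, α i := by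
  simp [dirs, List.length_flatMap, List.sum_ofFn, ← List.ofFn_id]

/-- A polynomial that vanishes on a ball is zero. -/
theorem eq_zero_of_polyFun_eq_zero_on_ball {d : ℕ} {p : MvPolynomial (Fin d) ℝ} {z : Pt d} {s : ℝ}
    (hs : 0 < s) (h : ∀ y ∈ Metric.closedBall z s, polyFun p y = 0) : p = 0 := by
  -- In the sup norm a small ball is a box, a product of infinite sets, and a polynomial vanishing
  -- on such a product is zero.
  have hopen : (WithLp.toLp 2 : (Fin d → ℝ) → Pt d) ⁻¹' Metric.ball z s ∈ nhds (fun i => z i) := by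
    apply (PiLp.continuous_toLp 2 _).continuousAt
    exact Metric.ball_mem_nhds _ hs
  rw [Metric.mem_nhds_iff] at hopen
  obtain ⟨ε, hε, hsub⟩ := hopen
  refine MvPolynomial.funext_set (fun i => Metric.ball (z i) ε) (fun i => ?_) fun x hx => ?_
  · rw [Real.ball_eq_Ioo]; exact Set.Ioo_infinite (by linarith)
  · have hx' : x ∈ Metric.ball (fun i => z i) ε := by
      rw [ball_pi _ hε]; exact hx
    have := h _ (Metric.ball_subset_closedBall (hsub hx'))
    simpa [polyFun] using this

/-- Linear maps on a finite-dimensional space are bounded by any injective linear map. -/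
theorem exists_norm_le_of_injective {V X Y : Type*} [AddCommGroup V] [Module ℝ V] [FiniteDimensional ℝ V]
    [NormedAddCommGroup X] [NormedSpace ℝ X] [NormedAddCommGroup Y] [NormedSpace ℝ Y]
    (E : V →ₗ[ℝ] X) (F : V →ₗ[ℝ] Y) (hE : Function.Injective E) :
    ∃ C : ℝ, 0 ≤ C ∧ ∀ v, ‖F v‖ ≤ C * ‖E v‖ := by
  let e := LinearEquiv.ofInjective E hE
  let G : LinearMap.range E →L[ℝ] Y := LinearMap.toContinuousLinearMap (F ∘ₗ e.symm.toLinearMap)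
  refine ⟨‖G‖, G.opNorm_nonneg, fun v => ?_⟩
  have h2 : F v = G (e v) := by simp [G]
  rw [h2]
  exact G.le_opNorm _

/-- On polynomials of bounded degree, the derivatives on a ball are controlled by the values
on the unit ball. -/
theorem exists_partialD_bound_unitBall (d m : ℕ) (α : Fin d → ℕ) (R : ℝ) :
    ∃ C : ℝ, 0 ≤ C ∧ ∀ p : MvPolynomial (Fin d) ℝ, p.totalDegree ≤ m → ∀ A : ℝ,
      (∀ w ∈ Metric.closedBall (0 : Pt d) 1, |polyFun p w| ≤ A) →
      ∀ w ∈ Metric.closedBall (0 : Pt d) R, |partialD α (polyFun p) w| ≤ C * A := by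
  have hK (ρ : ℝ) : CompactSpace (Metric.closedBall (0 : Pt d) ρ) :=
    isCompact_iff_compactSpace.1 (isCompact_closedBall _ _)
  have := hK 1
  have := hK R
  let V := restrictTotalDegree (Fin d) ℝ m
  let E : V →ₗ[ℝ] C(Metric.closedBall (0 : Pt d) 1, ℝ) :=
    { toFun := fun p => ⟨fun w => polyFun p.1 w.1,
        (contDiff_polyFun p.1 (n := 0)).continuous.comp continuous_subtype_val⟩
      map_add' := fun p q => by ext w; exact polyFun_add p.1 q.1 w.1
      map_smul' := fun a p => by ext w; exact polyFun_smul a p.1 w.1 }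
  let F : V →ₗ[ℝ] C(Metric.closedBall (0 : Pt d) R, ℝ) :=
    { toFun := fun p => ⟨fun w => partialD α (polyFun p.1) w.1,
        (continuous_partialD_polyFun α p.1).comp continuous_subtype_val⟩
      map_add' := fun p q => by ext w; exact partialD_polyFun_add α p.1 q.1 w.1
      map_smul' := fun a p => by ext w; exact partialD_polyFun_smul α a p.1 w.1 }
  have hE : Function.Injective E := by
    rw [← LinearMap.ker_eq_bot, LinearMap.ker_eq_bot']
    intro p hp
    apply Subtype.ext
    refine eq_zero_of_polyFun_eq_zero_on_ball (z := 0) one_pos fun y hy => ?_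
    exact DFunLike.congr_fun hp ⟨y, hy⟩
  obtain ⟨C, hC0, hC⟩ := exists_norm_le_of_injective E F hE
  refine ⟨C, hC0, fun p hp A hA w hw => ?_⟩
  let p' : V := ⟨p, (mem_restrictTotalDegree _ _ _).2 hp⟩
  have hA0 : 0 ≤ A := (abs_nonneg _).trans (hA 0 (by simp))
  have h1 : ‖E p'‖ ≤ A := (ContinuousMap.norm_le _ hA0).2 fun w => hA w.1 w.2
  calc |partialD α (polyFun p) w| = ‖F p' ⟨w, hw⟩‖ := rfl
    _ ≤ ‖F p'‖ := ContinuousMap.norm_coe_le_norm _ _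
    _ ≤ C * ‖E p'‖ := hC p'
    _ ≤ C * A := by gcongr

/-- The polynomial `w ↦ p (z + s w)`. -/
noncomputable def rescale {d : ℕ} (z : Pt d) (s : ℝ) (p : MvPolynomial (Fin d) ℝ) :
    MvPolynomial (Fin d) ℝ :=
  bind₁ (fun i => C (z i) + C s * X i) p

theorem polyFun_rescale {d : ℕ} (z : Pt d) (s : ℝ) (p : MvPolynomial (Fin d) ℝ) (w : Pt d) :
    polyFun (rescale z s p) w = polyFun p (z + s • w) := by
  simp only [polyFun, rescale, ← MvPolynomial.coe_aeval_eq_eval, RingHom.coe_coe, aeval_bind₁]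
  simp

theorem totalDegree_bind₁_le {σ τ R : Type*} [CommRing R] (f : σ → MvPolynomial τ R)
    (hf : ∀ i, (f i).totalDegree ≤ 1) (p : MvPolynomial σ R) :
    (bind₁ f p).totalDegree ≤ p.totalDegree := by
  classical
  conv_lhs => rw [p.as_sum, map_sum]
  refine (totalDegree_finsetSum _ _).trans (Finset.sup_le fun v hv => ?_)
  rw [bind₁_monomial]
  refine (totalDegree_mul _ _).trans ?_
  rw [totalDegree_C, zero_add]
  refine (totalDegree_finsetProd _ _).trans ?_
  refine le_trans (Finset.sum_le_sum fun i _ => (totalDegree_pow _ _).trans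
    (Nat.mul_le_mul_left _ (hf i))) ?_
  simpa [Finsupp.sum] using le_totalDegree hv

theorem totalDegree_rescale_le {d : ℕ} (z : Pt d) (s : ℝ) (p : MvPolynomial (Fin d) ℝ) :
    (rescale z s p).totalDegree ≤ p.totalDegree := by
  refine totalDegree_bind₁_le _ (fun i => ?_) p
  refine (totalDegree_add _ _).trans (max_le (by simp) ?_)
  refine (totalDegree_mul _ _).trans ?_
  simp

theorem partialD_rescale {d : ℕ} (α : Fin d → ℕ) (z : Pt d) (s : ℝ) (p : MvPolynomial (Fin d) ℝ)
    (w : Pt d) : partialD α (polyFun (rescale z s p)) w =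
      s ^ (∑ i, α i) * partialD α (polyFun p) (z + s • w) := by
  have h : polyFun (rescale z s p) =
      (fun y => polyFun p (z + y)) ∘ (s • ContinuousLinearMap.id ℝ (Pt d)) := by
    funext w; simp [polyFun_rescale]
  have hc : ContDiff ℝ ⊤ fun y => polyFun p (z + y) :=
    (contDiff_polyFun p).comp (contDiff_const.add contDiff_id)
  rw [partialD, h, ContinuousLinearMap.iteratedFDeriv_comp_right _ hc _ (by exact_mod_cast le_top),
    iteratedFDeriv_comp_add_left]
  simp only [ContinuousMultilinearMap.compContinuousLinearMap_apply, _root_.smul_apply,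
    ContinuousLinearMap.id_apply]
  rw [ContinuousMultilinearMap.map_smul_univ]
  simp [partialD, length_dirs]

/-- Scaled version of `exists_partialD_bound_unitBall`. -/
theorem exists_partialD_bound (d m : ℕ) (α : Fin d → ℕ) (R : ℝ) :
    ∃ C : ℝ, 0 ≤ C ∧ ∀ p : MvPolynomial (Fin d) ℝ, p.totalDegree ≤ m → ∀ (A s : ℝ) (z : Pt d),
      0 < s → (∀ y ∈ Metric.closedBall z s, |polyFun p y| ≤ A) →
      ∀ y ∈ Metric.closedBall z (R * s),
        s ^ (∑ i, α i) * |partialD α (polyFun p) y| ≤ C * A := by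
  obtain ⟨C, hC0, hC⟩ := exists_partialD_bound_unitBall d m α R
  refine ⟨C, hC0, fun p hp A s z hs hA y hy => ?_⟩
  have key := hC (rescale z s p) ((totalDegree_rescale_le z s p).trans hp) A (fun w hw => ?_)
    (s⁻¹ • (y - z)) ?_
  · rw [partialD_rescale, smul_smul, mul_inv_cancel₀ hs.ne', one_smul, add_sub_cancel, abs_mul,
      abs_of_pos (by positivity)] at key
    exact key
  · rw [polyFun_rescale]
    apply hA
    simp only [mem_closedBall_iff_norm, add_sub_cancel_left, sub_zero] at hw ⊢
    rw [norm_smul, Real.norm_eq_abs, abs_of_pos hs]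
    nlinarith
  · simp only [mem_closedBall_iff_norm, sub_zero] at hy ⊢
    rw [norm_smul, Real.norm_eq_abs, abs_of_pos (by positivity), inv_mul_le_iff₀ hs]
    linarith

/-- Derivatives of order larger than the degree vanish. -/
theorem partialD_polyFun_eq_zero {d : ℕ} (α : Fin d → ℕ) (p : MvPolynomial (Fin d) ℝ)
    (h : p.totalDegree < ∑ i, α i) (x : Pt d) : partialD α (polyFun p) x = 0 := by
  obtain ⟨C, hC0, hC⟩ := exists_partialD_bound d p.totalDegree α 1
  set q := rescale x 1 p with hq
  have hqd : q.totalDegree ≤ p.totalDegree := totalDegree_rescale_le _ _ _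
  set S : ℝ := ∑ v ∈ q.support, |q.coeff v| with hS
  have hS0 : 0 ≤ S := Finset.sum_nonneg fun _ _ => abs_nonneg _
  -- On the ball of radius `s ≥ 1` the polynomial grows at most like `s ^ deg`, while the derivative
  -- estimate gains `s ^ |α|` with `|α| > deg`; letting `s → ∞` kills the derivative.
  have bound (s : ℝ) (hs : 1 ≤ s) : |partialD α (polyFun q) 0| ≤ C * S / s := by
    have hs0 : 0 < s := by linarith
    have hle := hC q hqd (S * s ^ p.totalDegree) s 0 hs0 (fun y hy => ?_) 0
      (by simp [hs0.le])
    · obtain ⟨k, hk⟩ := Nat.exists_eq_add_of_lt h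
      rw [hk, pow_succ, pow_add] at hle
      have h1 : 0 < s ^ p.totalDegree := by positivity
      have h2 : 1 ≤ s ^ k := one_le_pow₀ hs
      rw [le_div_iff₀ hs0]
      have h3 : s ^ p.totalDegree * (|partialD α (polyFun q) 0| * s * s ^ k) ≤
          s ^ p.totalDegree * (C * S) := by nlinarith
      have h4 := le_of_mul_le_mul_left h3 h1
      refine le_trans (le_mul_of_one_le_right (by positivity) h2) h4
    · rw [polyFun, eval_eq]
      refine (Finset.abs_sum_le_sum_abs _ _).trans ?_
      rw [hS, Finset.sum_mul]
      refine Finset.sum_le_sum fun v hv => ?_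
      rw [abs_mul]
      gcongr
      rw [Finset.abs_prod]
      calc ∏ i ∈ v.support, |y i ^ v i| ≤ ∏ i ∈ v.support, s ^ v i := by
            refine Finset.prod_le_prod (fun _ _ => abs_nonneg _) fun i _ => ?_
            rw [abs_pow]
            gcongr
            have : ‖y‖ ≤ s := by simpa using hy
            exact (PiLp.norm_apply_le y i).trans this
        _ = s ^ (∑ i ∈ v.support, v i) := Finset.prod_pow_eq_pow_sum _ _ _
        _ ≤ s ^ p.totalDegree :=
            pow_le_pow_right₀ hs ((le_totalDegree hv).trans hqd)
  have h0 : partialD α (polyFun q) 0 = 0 := by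
    have hlim : Filter.Tendsto (fun s : ℝ => C * S / s) Filter.atTop (nhds 0) :=
      Filter.Tendsto.const_div_atTop Filter.tendsto_id _
    have := ge_of_tendsto hlim (Filter.eventually_atTop.2 ⟨1, fun s hs => bound s hs⟩)
    exact abs_eq_zero.1 (le_antisymm this (abs_nonneg _))
  rw [hq, partialD_rescale] at h0
  simpa using h0


/-! ### Markov's inequality and norming sets -/

/-- **Markov's inequality at the endpoint** `1` of `[-1, 1]`. -/
theorem abs_derivative_eval_one_le {m : ℕ} {P : Polynomial ℝ} (hP : P.degree ≤ m) {A : ℝ}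
    (hA : ∀ x ∈ Set.Icc (-1 : ℝ) 1, |P.eval x| ≤ A) :
    |P.derivative.eval 1| ≤ m ^ 2 * A := by
  have one_sided (Q : Polynomial ℝ) (hQ : Q.degree ≤ m) (B : ℝ) (hB : 0 < B)
      (hQB : ∀ x ∈ Set.Icc (-1 : ℝ) 1, |Q.eval x| ≤ B) : Q.derivative.eval 1 ≤ m ^ 2 * B := by
    have h := Polynomial.Chebyshev.eval_iterate_derivative_le_of_forall_abs_le_one
      (n := m) (P := Polynomial.C B⁻¹ * Q) (k := 1) le_rfl
      ((Polynomial.degree_C_mul (inv_ne_zero hB.ne')).trans_le hQ) (fun x hx => by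
        rw [Polynomial.eval_mul, Polynomial.eval_C, abs_mul, abs_of_pos (inv_pos.2 hB),
          inv_mul_le_iff₀ hB, mul_one]
        exact hQB x hx)
    rw [Function.iterate_one, Polynomial.derivative_C_mul, Polynomial.eval_mul, Polynomial.eval_C,
      Polynomial.Chebyshev.derivative_T_eval_one, inv_mul_le_iff₀ hB] at h
    rw [mul_comm]
    exact_mod_cast h
  have hA0 : 0 ≤ A := (abs_nonneg _).trans (hA 0 (by simp))
  -- Normalizing divides by the bound, and `A` may be `0`; hence the detour through `B > A` and a
  -- limit.
  have strict (B : ℝ) (hB : A < B) : |P.derivative.eval 1| ≤ m ^ 2 * B := by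
    rw [abs_le']
    refine ⟨one_sided P hP B (hA0.trans_lt hB) fun x hx => (hA x hx).trans hB.le, ?_⟩
    have := one_sided (-P) (by rwa [Polynomial.degree_neg]) B (hA0.trans_lt hB) fun x hx => by
      rw [Polynomial.eval_neg, abs_neg]; exact (hA x hx).trans hB.le
    simpa using this
  have hlim : Filter.Tendsto (fun B : ℝ => (m : ℝ) ^ 2 * B) (nhdsWithin A (Set.Ioi A))
      (nhds (m ^ 2 * A)) :=
    (Continuous.tendsto (by fun_prop) A).mono_left nhdsWithin_le_nhds
  exact ge_of_tendsto hlim (Filter.eventually_of_mem self_mem_nhdsWithin fun B hB => strict B hB)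

/-- Markov's inequality at the left endpoint of `[a, b]`. -/
theorem abs_derivative_eval_left_le {m : ℕ} {P : Polynomial ℝ} (hP : P.degree ≤ m) {A a b : ℝ}
    (hab : a < b) (hA : ∀ x ∈ Set.Icc a b, |P.eval x| ≤ A) :
    |P.derivative.eval a| ≤ 2 * m ^ 2 / (b - a) * A := by
  set k : ℝ := (b - a) / 2 with hk
  have hk0 : 0 < k := by rw [hk]; linarith
  -- `L` is the decreasing affine map from `[-1, 1]` onto `[a, b]`, so the endpoint `1` goes to `a`.
  set L : Polynomial ℝ := Polynomial.C ((a + b) / 2) - Polynomial.C k * Polynomial.X with hL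
  have hLd : L.natDegree ≤ 1 := by
    rw [hL]
    refine (Polynomial.natDegree_sub_le _ _).trans (max_le (by simp) ?_)
    exact (Polynomial.natDegree_C_mul_le _ _).trans (by simp)
  have hdeg : (P.comp L).degree ≤ m := by
    refine Polynomial.natDegree_le_iff_degree_le.1 (Polynomial.natDegree_comp_le.trans ?_)
    calc P.natDegree * L.natDegree ≤ m * 1 :=
          Nat.mul_le_mul (Polynomial.natDegree_le_iff_degree_le.2 hP) hLd
      _ = m := mul_one m
  have h := abs_derivative_eval_one_le hdeg (A := A) fun x hx => by
    rw [Polynomial.eval_comp]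
    apply hA
    simp only [hL, Polynomial.eval_sub, Polynomial.eval_C, Polynomial.eval_mul, Polynomial.eval_X]
    constructor <;> nlinarith [hx.1, hx.2]
  have h1 : L.eval 1 = a := by simp [hL, hk]; ring
  have h2 : L.derivative.eval 1 = -k := by simp [hL]
  rw [Polynomial.derivative_comp, Polynomial.eval_mul, Polynomial.eval_comp, h1, h2, abs_mul,
    abs_neg, abs_of_pos hk0] at h
  rw [div_mul_eq_mul_div, le_div_iff₀ (by linarith)]
  rw [hk] at h
  nlinarith

/-- Each `x` in `[0, 1]` is the left endpoint of `[x, T]`, whose length is at least `T - 1`.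
Endpoint Markov therefore bounds the derivative on all of `[0, 1]`, and the mean value inequality
finishes. -/
theorem abs_eval_zero_sub_eval_one_le {m : ℕ} {P : Polynomial ℝ} (hP : P.degree ≤ m) {A T : ℝ}
    (hT : 1 < T) (hA : ∀ x ∈ Set.Icc 0 T, |P.eval x| ≤ A) :
    |P.eval 1 - P.eval 0| ≤ 2 * m ^ 2 / (T - 1) * A := by
  have hA0 : 0 ≤ A := (abs_nonneg _).trans (hA 0 ⟨le_rfl, by linarith⟩)
  have h := (convex_Icc (0 : ℝ) 1).norm_image_sub_le_of_norm_deriv_le (f := fun x => P.eval x)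
    (C := 2 * m ^ 2 / (T - 1) * A) (fun x _ => P.differentiableAt) (fun x hx => ?_)
    (Set.left_mem_Icc.2 zero_le_one) (Set.right_mem_Icc.2 zero_le_one)
  · simpa using h
  · rw [Polynomial.deriv, Real.norm_eq_abs]
    refine (abs_derivative_eval_left_le hP (by linarith [hx.2])
      (fun y hy => hA y ⟨hx.1.trans hy.1, hy.2⟩)).trans ?_
    have := hx.2
    have h1 : 0 < T - 1 := by linarith
    gcongr

/-- The restriction of a polynomial to a line is a polynomial. -/
theorem exists_polynomial_on_line {d m : ℕ} {p : MvPolynomial (Fin d) ℝ} (hp : p.totalDegree ≤ m)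
    (y v : Pt d) : ∃ P : Polynomial ℝ, P.degree ≤ m ∧ ∀ t, P.eval t = polyFun p (y + t • v) := by
  refine ⟨aeval (fun i => Polynomial.C (y i) + Polynomial.C (v i) * Polynomial.X) p, ?_, fun t => ?_⟩
  · refine Polynomial.natDegree_le_iff_degree_le.1 ((aeval_natDegree_le p hp _ (n := 1)
      fun i => ?_).trans (by simp))
    refine (Polynomial.natDegree_add_le _ _).trans (max_le (by simp) ?_)
    exact (Polynomial.natDegree_C_mul_le _ _).trans (by simp)
  · rw [polyFun, ← Polynomial.coe_evalRingHom, MvPolynomial.aeval_def, MvPolynomial.hom_eval₂]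
    rw [MvPolynomial.eval, MvPolynomial.coe_eval₂Hom]
    congr 1
    · ext a; simp
    · funext i; simp; ring

/-- If the point `y + T (w - y)` of the ray from `y` through `w` still lies in a ball, then a
polynomial bounded by `A` on the ball varies by at most `2 A / 3` from `y` to `w`. -/
theorem abs_polyFun_sub_le_on_chord {d m : ℕ} (hm : 0 < m) {p : MvPolynomial (Fin d) ℝ}
    (hp : p.totalDegree ≤ m) {z y w : Pt d} {s A : ℝ}
    (hA : ∀ x ∈ Metric.closedBall z s, |polyFun p x| ≤ A) (hy : y ∈ Metric.closedBall z s)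
    (hw : y + (1 + 3 * (m : ℝ) ^ 2) • (w - y) ∈ Metric.closedBall z s) :
    |polyFun p w - polyFun p y| ≤ 2 / 3 * A := by
  obtain ⟨P, hPd, hP⟩ := exists_polynomial_on_line hp y (w - y)
  have hm' : (1 : ℝ) ≤ (m : ℝ) ^ 2 := one_le_pow₀ (by exact_mod_cast hm)
  have h := abs_eval_zero_sub_eval_one_le (T := 1 + 3 * (m : ℝ) ^ 2) (A := A) hPd (by linarith)
    fun t ht => by
      rw [hP]
      apply hA
      have h1 := (convex_closedBall z s).add_smul_sub_mem hy hw
        (t := t / (1 + 3 * (m : ℝ) ^ 2)) ⟨by have := ht.1; positivity,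
          (div_le_one (by positivity)).2 ht.2⟩
      rwa [add_sub_cancel_left, smul_smul, div_mul_cancel₀ _ (by positivity)] at h1
  rw [hP, hP, one_smul, add_sub_cancel, zero_smul, add_zero] at h
  convert h using 2
  field_simp
  ring

/-- From every point `y` of a ball of radius `s = 10 m² h` there is a point `w` of an `h`-dense set
such that the ray from `y` through `w` stays long inside the ball. -/
theorem exists_long_chord {d m : ℕ} (hm : 0 < m) {M : Finset (Pt d)} {z y : Pt d} {h s : ℝ}
    (hh : 0 < h) (hs : s = 10 * (m : ℝ) ^ 2 * h)
    (hM : ∀ x ∈ Metric.closedBall z s, ∃ w ∈ M, ‖x - w‖ ≤ h) (hy : y ∈ Metric.closedBall z s) :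
    ∃ w ∈ M, y + (1 + 3 * (m : ℝ) ^ 2) • (w - y) ∈ Metric.closedBall z s := by
  have hm' : (1 : ℝ) ≤ (m : ℝ) ^ 2 := one_le_pow₀ (by exact_mod_cast hm)
  set T : ℝ := 1 + 3 * (m : ℝ) ^ 2 with hT
  -- `T ≤ 4 m²` because `m ≥ 1`.
  have hTh : T * h ≤ 2 / 5 * s := by rw [hT, hs]; nlinarith
  have hT0 : 0 < T := by positivity
  have hsh : 10 * h ≤ s := by rw [hs]; nlinarith
  rw [mem_closedBall_iff_norm] at hy
  rcases le_total ‖y - z‖ (s / 2) with hcase | hcase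
  · obtain ⟨w, hwM, hw⟩ := hM y (mem_closedBall_iff_norm.2 hy)
    refine ⟨w, hwM, mem_closedBall_iff_norm.2 ?_⟩
    calc ‖y + T • (w - y) - z‖ = ‖(y - z) + T • (w - y)‖ := by congr 1; abel
      _ ≤ ‖y - z‖ + T * ‖w - y‖ := by
        refine (norm_add_le _ _).trans ?_
        rw [norm_smul, Real.norm_eq_abs, abs_of_pos hT0]
      _ ≤ s / 2 + T * h := by
        rw [norm_sub_rev w y]; gcongr
      _ ≤ s := by linarith
  -- Far from the center, aim at the point `2h` from `y` towards `z`. A data point within `h` of it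
  -- deviates in direction by at most 30°, and `43 / 50` is a rational lower bound for cos 30° =
  -- √3/2.
  · set ρ := ‖y - z‖ with hρ
    have hρ0 : 0 < ρ := by linarith
    obtain ⟨w, hwM, hw⟩ := hM (y + (2 * h / ρ) • (z - y)) (by
      rw [mem_closedBall_iff_norm]
      have : y + (2 * h / ρ) • (z - y) - z = (1 - 2 * h / ρ) • (y - z) := by
        module
      rw [this, norm_smul, Real.norm_eq_abs, ← hρ, abs_of_nonneg]
      · have : (1 - 2 * h / ρ) * ρ = ρ - 2 * h := by field_simp
        linarith
      · rw [sub_nonneg, div_le_one hρ0]; linarith)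
    refine ⟨w, hwM, mem_closedBall_iff_norm.2 ?_⟩
    set b := z - y with hb
    set v := w - y with hv
    set t := ‖v‖ with ht
    have ht0 : 0 ≤ t := norm_nonneg _
    have hbρ : ‖b‖ = ρ := by rw [hρ, hb, norm_sub_rev]
    have hw' : ‖v - (2 * h / ρ) • b‖ ≤ h := by
      have h1 : v - (2 * h / ρ) • b = -(y + (2 * h / ρ) • b - w) := by rw [hv]; abel
      rwa [h1, norm_neg]
    have hsq : t ^ 2 - 2 * (2 * h / ρ) * inner ℝ v b + (2 * h) ^ 2 ≤ h ^ 2 := by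
      have h1 : ‖v - (2 * h / ρ) • b‖ ^ 2 = t ^ 2 - 2 * (2 * h / ρ) * inner ℝ v b + (2 * h) ^ 2 := by
        rw [norm_sub_sq_real, inner_smul_right, norm_smul, hbρ, Real.norm_eq_abs,
          abs_of_pos (by positivity), ← ht]
        field_simp
      rw [← h1]
      exact pow_le_pow_left₀ (norm_nonneg _) hw' 2
    have ht3 : t ≤ 3 * h := by
      have h1 : t ≤ ‖v - (2 * h / ρ) • b‖ + ‖(2 * h / ρ) • b‖ := norm_le_norm_sub_add _ _
      have h2 : ‖(2 * h / ρ) • b‖ = 2 * h := by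
        rw [norm_smul, hbρ, Real.norm_eq_abs, abs_of_pos (by positivity)]
        field_simp
      linarith
    have hinner : 43 / 50 * t * ρ ≤ inner ℝ v b := by
      have h1 : 4 * h * (inner ℝ v b / ρ) ≥ t ^ 2 + 3 * h ^ 2 := by
        have : 2 * (2 * h / ρ) * inner ℝ v b = 4 * h * (inner ℝ v b / ρ) := by ring
        rw [this] at hsq
        linarith
      have h2 : t ^ 2 + 3 * h ^ 2 ≥ 4 * h * (43 / 50 * t) := by
        nlinarith [sq_nonneg (t - 43 / 25 * h), sq_nonneg h]
      have h3 : 43 / 50 * t ≤ inner ℝ v b / ρ :=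
        le_of_mul_le_mul_left (h2.trans h1) (by positivity)
      rwa [le_div_iff₀ hρ0] at h3
    have hτ : T * t ≤ 6 / 5 * s := by nlinarith
    have hτ0 : 0 ≤ T * t := by positivity
    have hnorm : ‖y + T • v - z‖ ^ 2 = ρ ^ 2 - 2 * T * inner ℝ v b + (T * t) ^ 2 := by
      have : y + T • v - z = T • v - b := by rw [hb]; abel
      rw [this, norm_sub_sq_real, norm_smul, inner_smul_left, hbρ, Real.norm_eq_abs,
        abs_of_pos hT0]
      simp
      ring
    have hs0 : 0 ≤ s := by linarith
    refine le_of_sq_le_sq ?_ hs0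
    rw [hnorm]
    have h4 : 2 * T * inner ℝ v b ≥ 43 / 25 * (T * t) * ρ := by nlinarith
    set τ := T * t
    have h5 : τ ^ 2 ≤ τ * (6 / 5 * s) := by nlinarith
    -- What remains is `ρ² - (43/25) τ ρ + τ² ≤ s²` for `s / 2 ≤ ρ ≤ s` and `0 ≤ τ ≤ 6 s / 5`.
    nlinarith [mul_nonneg hτ0 (sub_nonneg.2 hcase), mul_nonneg (sub_nonneg.2 hcase) (sub_nonneg.2 hy),
      mul_nonneg (sub_nonneg.2 hτ) (sub_nonneg.2 hy), mul_nonneg hτ0 (sub_nonneg.2 hy)]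

/-- An `h`-dense set is a norming set for the polynomials of degree at most `m` on a ball of radius
`10 m² h`. -/
theorem norming_on_ball {d m : ℕ} (hm : 0 < m) {p : MvPolynomial (Fin d) ℝ}
    (hp : p.totalDegree ≤ m) {M : Finset (Pt d)} {z : Pt d} {h s A : ℝ}
    (hh : 0 < h) (hs : s = 10 * (m : ℝ) ^ 2 * h)
    (hM : ∀ x ∈ Metric.closedBall z s, ∃ w ∈ M, ‖x - w‖ ≤ h)
    (hA : ∀ w ∈ M, w ∈ Metric.closedBall z s → |polyFun p w| ≤ A) :
    ∀ y ∈ Metric.closedBall z s, |polyFun p y| ≤ 3 * A := by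
  have hs0 : 0 ≤ s := by rw [hs]; positivity
  -- At a maximum point `y` of the modulus, `|p y| ≤ |p w| + (2/3) |p y|`, which gives the factor
  -- `3`.
  obtain ⟨y, hy, hmax⟩ := (isCompact_closedBall z s).exists_isMaxOn
    ⟨z, Metric.mem_closedBall_self hs0⟩
    ((contDiff_polyFun p (n := 0)).continuous.abs.continuousOn)
  have hmax' : ∀ x ∈ Metric.closedBall z s, |polyFun p x| ≤ |polyFun p y| := fun x hx => hmax hx
  obtain ⟨w, hwM, hw⟩ := exists_long_chord hm hh hs hM hy
  have hwball : w ∈ Metric.closedBall z s := by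
    have h1 := (convex_closedBall z s).add_smul_sub_mem hy hw (t := 1 / (1 + 3 * (m : ℝ) ^ 2))
      ⟨by positivity, (div_le_one (by positivity)).2 (by nlinarith [sq_nonneg (m : ℝ)])⟩
    rwa [add_sub_cancel_left, smul_smul, div_mul_cancel₀ _ (by positivity), one_smul,
      add_sub_cancel] at h1
  have h1 := abs_polyFun_sub_le_on_chord hm hp hmax' hy hw
  have h2 := hA w hwM hwball
  have h3 : |polyFun p y| ≤ |polyFun p w| + |polyFun p w - polyFun p y| := by
    have := abs_sub_abs_le_abs_sub (polyFun p y) (polyFun p w)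
    rw [abs_sub_comm (polyFun p y)] at this
    linarith
  intro x hx
  linarith [hmax' x hx]

/-! ### Balls in cones -/

/-- A ball inscribed in a cone. -/
theorem closedBall_subset_cone {d : ℕ} {x ξ : Pt d} {θ s R : ℝ} (hξ : ‖ξ‖ = 1) (hs : 0 < s)
    (hθ : 0 < Real.sin θ) (hR : s / Real.sin θ + s ≤ R) :
    Metric.closedBall (x + (s / Real.sin θ) • ξ) s ⊆ cone x ξ θ R := by
  intro g hg
  set σ := Real.sin θ with hσ
  set κ := s / σ with hκ
  have hκ0 : 0 < κ := by positivity
  set w := g - x with hw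
  have hgw : ‖w - κ • ξ‖ ≤ s := by
    rw [mem_closedBall_iff_norm] at hg
    have h1 : w - κ • ξ = g - (x + κ • ξ) := by rw [hw]; abel
    rwa [h1]
  have hnκ : ‖κ • ξ‖ = κ := by rw [norm_smul, hξ, Real.norm_eq_abs, abs_of_pos hκ0, mul_one]
  by_cases hw0 : w = 0
  · refine ⟨0, ξ, le_rfl, by linarith, hξ, ?_, ?_⟩
    · rw [real_inner_self_eq_norm_sq, hξ]; simpa using Real.cos_le_one θ
    · rw [zero_smul, add_zero]; exact sub_eq_zero.1 hw0
  · have hwn : 0 < ‖w‖ := norm_pos_iff.2 hw0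
    refine ⟨‖w‖, ‖w‖⁻¹ • w, hwn.le, ?_, ?_, ?_, ?_⟩
    · have := norm_le_norm_sub_add w (κ • ξ)
      linarith
    · rw [norm_smul, norm_inv, norm_norm, inv_mul_cancel₀ hwn.ne']
    · rw [inner_smul_left]
      simp only [conj_trivial]
      rw [le_inv_mul_iff₀ hwn]
      have h1 : ‖w - κ • ξ‖ ^ 2 ≤ s ^ 2 := pow_le_pow_left₀ (norm_nonneg _) hgw 2
      rw [norm_sub_sq_real, hnκ, inner_smul_right] at h1
      have h2 : s = κ * σ := by rw [hκ]; field_simp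
      have h3 : σ ^ 2 + Real.cos θ ^ 2 = 1 := Real.sin_sq_add_cos_sq θ
      -- Expanding `‖w - κ ξ‖² ≤ κ² sin² θ` gives `2 κ ⟪w, ξ⟫ ≥ ‖w‖² + κ² cos² θ`, and the right
      -- side is at least `2 κ ‖w‖ cos θ`.
      have h4 : 2 * κ * (‖w‖ * Real.cos θ) ≤ 2 * κ * inner ℝ w ξ := by
        have h5 : s ^ 2 = κ ^ 2 * (1 - Real.cos θ ^ 2) := by rw [h2, ← h3]; ring
        nlinarith [sq_nonneg (‖w‖ - κ * Real.cos θ)]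
      exact le_of_mul_le_mul_left h4 (by positivity)
    · rw [smul_smul, mul_inv_cancel₀ hwn.ne', one_smul, hw, add_sub_cancel]


/-! ### Symmetry of higher derivatives -/

/-- If the values of `g` are symmetric bilinear maps near `x`, so are those of its derivatives. -/
theorem iteratedFDeriv_apply_comm {E F : Type*} [NormedAddCommGroup E] [NormedSpace ℝ E]
    [NormedAddCommGroup F] [NormedSpace ℝ F] {g : E → E →L[ℝ] E →L[ℝ] F} {x : E} {k : ℕ}
    (hg : ContDiffAt ℝ k g x) (hsymm : ∀ᶠ y in nhds x, ∀ a b, g y a b = g y b a)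
    (u : Fin k → E) (a b : E) :
    iteratedFDeriv ℝ k g x u a b = iteratedFDeriv ℝ k g x u b a := by
  let ev (a b : E) : (E →L[ℝ] E →L[ℝ] F) →L[ℝ] F :=
    (ContinuousLinearMap.apply ℝ F b).comp (ContinuousLinearMap.apply ℝ (E →L[ℝ] F) a)
  have key (a b : E) : iteratedFDeriv ℝ k (ev a b ∘ g) x u = iteratedFDeriv ℝ k g x u a b := by
    rw [ContinuousLinearMap.iteratedFDeriv_comp_left (ev a b) hg le_rfl]
    rfl
  have hev : ev a b ∘ g =ᶠ[nhds x] ev b a ∘ g := by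
    filter_upwards [hsymm] with y hy using hy a b
  rw [← key, ← key, (hev.iteratedFDeriv ℝ k).eq_of_nhds]

/-- The iterated derivative of order `n` of a `C^n` function over `ℝ` is symmetric. -/
theorem iteratedFDeriv_comp_perm {E F : Type} [NormedAddCommGroup E] [NormedSpace ℝ E]
    [NormedAddCommGroup F] [NormedSpace ℝ F] {f : E → F} {x : E} {n : ℕ}
    (hf : ContDiffAt ℝ n f x) (v : Fin n → E) (σ : Equiv.Perm (Fin n)) :
    iteratedFDeriv ℝ n f x (v ∘ σ) = iteratedFDeriv ℝ n f x v := by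
  induction n generalizing F with
  | zero => rw [Subsingleton.elim (v ∘ σ) v]
  | succ n ih =>
    -- The permutations leaving the derivative invariant form a submonoid, so adjacent
    -- transpositions suffice.
    let S : Submonoid (Equiv.Perm (Fin (n + 1))) :=
      { carrier := {τ | ∀ v : Fin (n + 1) → E,
          iteratedFDeriv ℝ (n + 1) f x (v ∘ τ) = iteratedFDeriv ℝ (n + 1) f x v}
        one_mem' := fun v => rfl
        mul_mem' := fun {τ ρ} hτ hρ v => by
          rw [Equiv.Perm.coe_mul, ← Function.comp_assoc, hρ, hτ] }
    suffices h : S = ⊤ by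
      have : σ ∈ S := h ▸ Submonoid.mem_top σ
      exact this v
    rw [← top_le_iff, ← Equiv.Perm.mclosure_swap_castSucc_succ, Submonoid.closure_le]
    rintro _ ⟨i, rfl⟩ w
    induction n with
    | zero => exact i.elim0
    | succ k _ =>
      have hf1 : ContDiffAt ℝ (k + 1 : ℕ) (fderiv ℝ f) x :=
        hf.fderiv_right (by norm_cast)
      -- A transposition that fixes the last index is covered by induction applied to `fderiv ℝ f`;
      -- the swap of the last two is the symmetry of the second derivative, differentiated `k` more
      -- times.
      rcases Fin.eq_castSucc_or_eq_last i with ⟨j, rfl⟩ | rfl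
      · have expand (u : Fin (k + 2) → E) : iteratedFDeriv ℝ (k + 2) f x u =
            iteratedFDeriv ℝ (k + 1) (fderiv ℝ f) x (Fin.init u) (u (Fin.last (k + 1))) :=
          iteratedFDeriv_succ_apply_right u
        rw [expand, expand]
        have h1 : Fin.init (w ∘ Equiv.swap j.castSucc.castSucc j.castSucc.succ) =
            Fin.init w ∘ Equiv.swap j.castSucc j.succ := by
          funext a
          simp only [Fin.init, Function.comp_apply]
          congr 1
          rw [Fin.succ_castSucc]
          exact ((Fin.castSucc_injective _).map_swap _ _ _).symm
        have h2 : (w ∘ Equiv.swap j.castSucc.castSucc j.castSucc.succ) (Fin.last (k + 1)) =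
            w (Fin.last (k + 1)) := by
          simp only [Function.comp_apply]
          rw [Equiv.swap_apply_of_ne_of_ne]
          · exact (Fin.castSucc_lt_last _).ne'
          · rw [Fin.succ_castSucc]; exact (Fin.castSucc_lt_last _).ne'
        rw [h1, h2]
        exact congrArg (fun L : E →L[ℝ] F => L (w (Fin.last (k + 1)))) (ih hf1 (Fin.init w) _)
      · have hsymm : ∀ᶠ y in nhds x, ∀ a b,
            fderiv ℝ (fderiv ℝ f) y a b = fderiv ℝ (fderiv ℝ f) y b a := by
          filter_upwards [hf.eventually (by simp)] with y hy a b
          exact (hy.isSymmSndFDerivAt (by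
            rw [minSmoothness_of_isRCLikeNormedField]
            exact_mod_cast Nat.le_add_left 2 k)).eq a b
        have hf2 : ContDiffAt ℝ k (fderiv ℝ (fderiv ℝ f)) x :=
          hf1.fderiv_right (by norm_cast)
        have expand (u : Fin (k + 2) → E) : iteratedFDeriv ℝ (k + 2) f x u =
            iteratedFDeriv ℝ k (fderiv ℝ (fderiv ℝ f)) x (Fin.init (Fin.init u))
              (u (Fin.last k).castSucc) (u (Fin.last (k + 1))) := by
          rw [iteratedFDeriv_succ_apply_right, iteratedFDeriv_succ_apply_right]
          rfl
        rw [expand, expand]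
        have h1 : Fin.init (Fin.init (w ∘ Equiv.swap (Fin.last k).castSucc (Fin.last k).succ)) =
            Fin.init (Fin.init w) := by
          funext a
          simp only [Fin.init, Function.comp_apply]
          rw [Equiv.swap_apply_of_ne_of_ne]
          · exact fun h => (Fin.castSucc_lt_last a).ne (Fin.castSucc_injective _ h)
          · rw [Fin.succ_last]; exact (Fin.castSucc_lt_last _).ne
        rw [h1]
        simp only [Function.comp_apply, Equiv.swap_apply_left]
        rw [← Fin.succ_last, Equiv.swap_apply_right]
        exact iteratedFDeriv_apply_comm hf2 hsymm _ _ _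

/-- Two tuples with the same entries up to order differ by a permutation of the indices. -/
theorem exists_comp_perm_eq {β : Type*} [LinearOrder β] {n : ℕ} {a b : Fin n → β}
    (h : (List.ofFn a).Perm (List.ofFn b)) : ∃ σ : Equiv.Perm (Fin n), a ∘ σ = b := by
  have h1 : a ∘ Tuple.sort a = b ∘ Tuple.sort b :=
    List.ofFn_injective <|
      (((Tuple.sort a).ofFn_comp_perm a).trans
        (h.trans ((Tuple.sort b).ofFn_comp_perm b).symm)).eq_of_pairwise'
        (Tuple.monotone_sort a).sortedLE_ofFn.pairwise (Tuple.monotone_sort b).sortedLE_ofFn.pairwise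
  refine ⟨(Tuple.sort b).symm.trans (Tuple.sort a), ?_⟩
  rw [Equiv.coe_trans, ← Function.comp_assoc, h1, Function.comp_assoc]
  funext i
  simp

/-- Counting the occurrences of each direction gives the multi-index whose fixed listing `dirs`
reorders the given tuple. -/
theorem perm_dirs {d n : ℕ} (σ : Fin n → Fin d) :
    (List.ofFn σ).Perm (dirs fun i => (List.ofFn σ).count i) := by
  rw [List.perm_iff_count]
  intro i
  rw [dirs, List.count_flatMap]
  simp only [Function.comp_def, List.count_replicate]
  rw [← List.ofFn_id, List.map_ofFn, List.sum_ofFn]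
  simp

/-- Mixed derivatives in arbitrary order of the coordinate directions are partial derivatives
`D^α`. -/
theorem exists_iteratedFDeriv_eq_partialD {d n : ℕ} {f : Pt d → ℝ} {x : Pt d}
    (hf : ContDiffAt ℝ n f x) (σ : Fin n → Fin d) : ∃ α : Fin d → ℕ, ∑ i, α i = n ∧
      iteratedFDeriv ℝ n f x (fun j => EuclideanSpace.single (σ j) (1 : ℝ)) = partialD α f x := by
  set α : Fin d → ℕ := fun i => (List.ofFn σ).count i with hα
  have hperm := perm_dirs σ
  rw [← hα] at hperm
  have hlen : (dirs α).length = n := by rw [← hperm.length_eq, List.length_ofFn]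
  refine ⟨α, by rw [← length_dirs, hlen], ?_⟩
  rw [partialD]
  generalize dirs α = L at hperm hlen
  subst hlen
  have h : (List.ofFn L.get).Perm (List.ofFn σ) := by rw [List.ofFn_get]; exact hperm.symm
  obtain ⟨τ, hτ⟩ := exists_comp_perm_eq h
  rw [← hτ]
  exact iteratedFDeriv_comp_perm hf (fun k => EuclideanSpace.single (L.get k) (1 : ℝ)) τ


/-! ### Taylor polynomials and the remainder -/

theorem sum_smul_single {d : ℕ} (w : Pt d) : w = ∑ i, w i • EuclideanSpace.single i (1 : ℝ) := by
  ext j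
  simp [Pi.single_apply]

/-- Expansion of a multilinear map on the diagonal in coordinates. -/
theorem multilinear_diag_expand {d k : ℕ}
    (f : ContinuousMultilinearMap ℝ (fun _ : Fin k => Pt d) ℝ) (w : Pt d) :
    f (fun _ => w) = ∑ σ : Fin k → Fin d,
      (∏ j, w (σ j)) * f fun j => EuclideanSpace.single (σ j) (1 : ℝ) := by
  conv_lhs => rw [sum_smul_single w]
  rw [ContinuousMultilinearMap.map_sum]
  refine Finset.sum_congr rfl fun σ _ => ?_
  rw [ContinuousMultilinearMap.map_smul_univ, smul_eq_mul]

/-- The Taylor polynomial of degree `m` of `u` at `x`. -/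
noncomputable def taylorPoly {d : ℕ} (m : ℕ) (u : Pt d → ℝ) (x : Pt d) : MvPolynomial (Fin d) ℝ :=
  ∑ k ∈ Finset.range (m + 1), ∑ σ : Fin k → Fin d,
    C ((k.factorial : ℝ)⁻¹ *
        iteratedFDeriv ℝ k u x fun j => EuclideanSpace.single (σ j) (1 : ℝ)) *
      ∏ j, (X (σ j) - C (x (σ j)))

theorem totalDegree_taylorPoly_le {d : ℕ} (m : ℕ) (u : Pt d → ℝ) (x : Pt d) :
    (taylorPoly m u x).totalDegree ≤ m := by
  refine (totalDegree_finsetSum _ _).trans (Finset.sup_le fun k hk => ?_)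
  refine (totalDegree_finsetSum _ _).trans (Finset.sup_le fun σ _ => ?_)
  refine (totalDegree_mul _ _).trans ?_
  rw [totalDegree_C, zero_add]
  refine (totalDegree_finsetProd _ _).trans ?_
  calc ∑ j : Fin k, (X (σ j) - C (x (σ j)) : MvPolynomial (Fin d) ℝ).totalDegree
      ≤ ∑ _j : Fin k, 1 := Finset.sum_le_sum fun j _ =>
        (totalDegree_sub_C_le _ _).trans (by simp)
    _ ≤ m := by simpa using Nat.lt_succ_iff.1 (Finset.mem_range.1 hk)

/-- The sum over ordered tuples of directions is exactly the expansion of a multilinear map on the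
diagonal, so no multinomial coefficients appear. -/
theorem polyFun_taylorPoly {d : ℕ} (m : ℕ) (u : Pt d → ℝ) (x y : Pt d) :
    polyFun (taylorPoly m u x) y = ∑ k ∈ Finset.range (m + 1),
      (k.factorial : ℝ)⁻¹ • iteratedFDeriv ℝ k u x fun _ => y - x := by
  rw [polyFun, taylorPoly, map_sum]
  refine Finset.sum_congr rfl fun k _ => ?_
  rw [multilinear_diag_expand, map_sum, Finset.smul_sum]
  refine Finset.sum_congr rfl fun σ _ => ?_
  rw [map_mul, eval_C, map_prod]
  simp only [map_sub, eval_X, eval_C, PiLp.sub_apply, smul_eq_mul]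
  ring

theorem polyFun_taylorPoly_self {d : ℕ} (m : ℕ) (u : Pt d → ℝ) (x : Pt d) :
    polyFun (taylorPoly m u x) x = u x := by
  rw [polyFun_taylorPoly, Finset.sum_range_succ']
  simp only [sub_self, Nat.factorial_zero, Nat.cast_one, inv_one, one_smul,
    iteratedFDeriv_zero_apply]
  rw [Finset.sum_eq_zero, zero_add]
  intro k _
  rw [ContinuousMultilinearMap.map_coord_zero _ 0 rfl, smul_zero]

/-- The `n`-th derivative of a power series at its center is the sum of its `n`-th coefficient over
all permutations of the arguments. By symmetry the `n!` terms agree and cancel the factor `1 / n!`.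
-/
theorem iteratedFDeriv_taylorPoly {d m n : ℕ} (hn : n ≤ m) {u : Pt d → ℝ} {x : Pt d}
    (hu : ContDiffAt ℝ n u x) (v : Fin n → Pt d) :
    iteratedFDeriv ℝ n (polyFun (taylorPoly m u x)) x v = iteratedFDeriv ℝ n u x v := by
  let q : FormalMultilinearSeries ℝ (Pt d) ℝ := fun k =>
    if k < m + 1 then (k.factorial : ℝ)⁻¹ • iteratedFDeriv ℝ k u x else 0
  have hq : HasFiniteFPowerSeriesOnBall (polyFun (taylorPoly m u x)) q x (m + 1) ⊤ := by
    refine HasFiniteFPowerSeriesOnBall.mk' (fun k hk => ?_) (by simp) fun y _ => ?_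
    · simp only [q, if_neg (not_lt.2 hk)]
    · rw [polyFun_taylorPoly, add_sub_cancel_left]
      refine Finset.sum_congr rfl fun k hk => ?_
      simp only [q, if_pos (Finset.mem_range.1 hk)]
      rfl
  rw [hq.toHasFPowerSeriesOnBall.iteratedFDeriv_eq_sum_of_completeSpace]
  have h1 (σ : Equiv.Perm (Fin n)) : q n (fun i => v (σ i)) =
      (n.factorial : ℝ)⁻¹ * iteratedFDeriv ℝ n u x v := by
    simp only [q, if_pos (Nat.lt_succ_of_le hn)]
    rw [← iteratedFDeriv_comp_perm hu v σ]
    rfl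
  simp only [h1, Finset.sum_const, Finset.card_univ, Fintype.card_perm, Fintype.card_fin,
    nsmul_eq_mul]
  rw [mul_inv_cancel_left₀ (by exact_mod_cast n.factorial_ne_zero)]

theorem partialD_taylorPoly {d m : ℕ} {u : Pt d → ℝ} {x : Pt d} (hu : ContDiffAt ℝ m u x)
    (α : Fin d → ℕ) (hα : ∑ i, α i ≤ m) :
    partialD α (polyFun (taylorPoly m u x)) x = partialD α u x := by
  rw [← length_dirs] at hα
  exact iteratedFDeriv_taylorPoly hα (hu.of_le (by exact_mod_cast hα)) _

/-- A real supremum over an unbounded set would be the junk value `0`. Boundedness holds because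
there are finitely many multi-indices and each derivative is continuous on a compact set. -/
theorem bddAbove_partialDWithin {d k : ℕ} {S : Set (Pt d)} {u : Pt d → ℝ} (hS : IsCompact S)
    (hSu : UniqueDiffOn ℝ S) (hu : ContDiffOn ℝ k u S) :
    BddAbove (Set.range fun z : {β : Fin d → ℕ // ∑ i, β i ≤ k} × S =>
      |partialDWithin z.1.1 u S z.2|) := by
  have hfin : Finite {β : Fin d → ℕ // ∑ i, β i ≤ k} := by
    refine Set.Finite.subset (Set.finite_Iic (fun _ : Fin d => k)) fun β hβ i => ?_
    exact (Finset.single_le_sum (fun _ _ => Nat.zero_le _) (Finset.mem_univ i)).trans hβ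
  have hB (β : {β : Fin d → ℕ // ∑ i, β i ≤ k}) :
      ∃ B, ∀ z ∈ S, |partialDWithin β.1 u S z| ≤ B := by
    have hc : ContinuousOn (iteratedFDerivWithin ℝ (dirs β.1).length u S) S :=
      hu.continuousOn_iteratedFDerivWithin (by rw [length_dirs]; exact_mod_cast β.2) hSu
    have hc' : ContinuousOn (partialDWithin β.1 u S) S :=
      (ContinuousMultilinearMap.apply ℝ (fun _ : Fin (dirs β.1).length => Pt d) ℝ
        _).continuous.comp_continuousOn hc
    obtain ⟨B, hB⟩ := hS.exists_bound_of_continuousOn hc'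
    exact ⟨B, hB⟩
  choose B hB using hB
  obtain ⟨K, hK⟩ := (Set.finite_range B).bddAbove
  refine ⟨K, ?_⟩
  rintro _ ⟨⟨β, z⟩, rfl⟩
  exact (hB β z z.2).trans (hK (Set.mem_range_self β))

theorem cNorm_nonneg {d : ℕ} (k : ℕ) (S : Set (Pt d)) (u : Pt d → ℝ) : 0 ≤ cNorm k S u :=
  Real.iSup_nonneg fun _ => abs_nonneg _

/-- Restricting `y` to the open ball makes the closed ball a neighborhood of `y`, so the derivative
within it is the full derivative. -/
theorem abs_partialD_le_cNorm {d k : ℕ} {x : Pt d} {δ : ℝ} {u : Pt d → ℝ}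
    (hδ : 0 < δ) (hu : ContDiffOn ℝ k u (Metric.closedBall x δ)) (α : Fin d → ℕ)
    (hα : ∑ i, α i ≤ k) {y : Pt d} (hy : y ∈ Metric.ball x δ) :
    |partialD α u y| ≤ cNorm k (Metric.closedBall x δ) u := by
  have hS : UniqueDiffOn ℝ (Metric.closedBall x δ) :=
    uniqueDiffOn_convex (convex_closedBall x δ)
      ⟨x, Metric.ball_subset_interior_closedBall (Metric.mem_ball_self hδ)⟩
  have hnhds : Metric.closedBall x δ ∈ nhds y := Metric.closedBall_mem_nhds_of_mem hy
  have heq : partialD α u y = partialDWithin α u (Metric.closedBall x δ) y := by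
    rw [partialD, partialDWithin, ← iteratedFDerivWithin_univ,
      iteratedFDerivWithin_congr_set (Filter.eventuallyEq_univ.mpr hnhds).symm]
  rw [heq]
  exact le_ciSup (bddAbove_partialDWithin (isCompact_closedBall x δ) hS hu)
    (⟨⟨α, hα⟩, ⟨y, Metric.ball_subset_closedBall hy⟩⟩ :
      {β : Fin d → ℕ // ∑ i, β i ≤ k} × Metric.closedBall x δ)

/-- Multivariate Taylor estimate on the open ball. -/
theorem abs_sub_taylorPoly_le_of_mem_ball {d m : ℕ} {x : Pt d} {δ : ℝ} {u : Pt d → ℝ}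
    (hu : ContDiffOn ℝ (m + 1 : ℕ) u (Metric.closedBall x δ)) {y : Pt d}
    (hy : y ∈ Metric.ball x δ) :
    |u y - polyFun (taylorPoly m u x) y| ≤
      (d : ℝ) ^ (m + 1) * ‖y - x‖ ^ (m + 1) * cNorm (m + 1) (Metric.closedBall x δ) u := by
  have hδ : 0 < δ := (norm_nonneg _).trans_lt (mem_ball_iff_norm.1 hy)
  set N := cNorm (m + 1) (Metric.closedBall x δ) u
  set w := y - x with hw
  have hsegment (t : ℝ) (ht : t ∈ Set.Icc (0 : ℝ) 1) : x + t • w ∈ Metric.ball x δ := by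
    rw [mem_ball_iff_norm, add_sub_cancel_left, norm_smul, Real.norm_eq_abs, abs_of_nonneg ht.1]
    exact (mul_le_of_le_one_left (norm_nonneg _) ht.2).trans_lt (mem_ball_iff_norm.1 hy)
  have hcd (z : Pt d) (hz : z ∈ Metric.ball x δ) : ContDiffAt ℝ (m + 1 : ℕ) u z :=
    hu.contDiffAt (Metric.closedBall_mem_nhds_of_mem hz)
  -- Taylor's formula with integral remainder along the segment from `x` to `y`.
  have hT := map_add_eq_sum_add_integral_iteratedFDeriv (f := u) (x := x) (y := w) (n := m)
    fun t ht => by exact_mod_cast hcd _ (hsegment t ht)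
  rw [← polyFun_taylorPoly, show x + w = y by rw [hw]; abel] at hT
  rw [hT, add_sub_cancel_left, smul_eq_mul, abs_mul]
  -- The factor `d ^ (m + 1)` counts the tuples of directions; symmetry identifies each mixed
  -- derivative with some `D^α`.
  have hD (z : Pt d) (hz : z ∈ Metric.ball x δ) :
      |iteratedFDeriv ℝ (m + 1) u z fun _ => w| ≤ (d : ℝ) ^ (m + 1) * ‖w‖ ^ (m + 1) * N := by
    rw [multilinear_diag_expand]
    refine (Finset.abs_sum_le_sum_abs _ _).trans ?_
    calc _ ≤ ∑ _σ : Fin (m + 1) → Fin d, ‖w‖ ^ (m + 1) * N := by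
          refine Finset.sum_le_sum fun σ _ => ?_
          rw [abs_mul]
          gcongr
          · rw [Finset.abs_prod]
            calc ∏ j, |w (σ j)| ≤ ∏ _j : Fin (m + 1), ‖w‖ :=
                  Finset.prod_le_prod (fun _ _ => abs_nonneg _) fun j _ => PiLp.norm_apply_le w (σ j)
              _ = ‖w‖ ^ (m + 1) := by simp
          · obtain ⟨α, hα, hαeq⟩ := exists_iteratedFDeriv_eq_partialD (hcd z hz) σ
            rw [hαeq]
            exact abs_partialD_le_cNorm hδ hu α hα.le hz
      _ = _ := by simp [mul_assoc]
  have hint : |∫ t in (0 : ℝ)..1, (1 - t) ^ m • iteratedFDeriv ℝ (m + 1) u (x + t • w) fun _ => w| ≤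
      (d : ℝ) ^ (m + 1) * ‖w‖ ^ (m + 1) * N := by
    have := intervalIntegral.norm_integral_le_of_norm_le_const (a := (0 : ℝ)) (b := 1)
      (f := fun t => (1 - t) ^ m • iteratedFDeriv ℝ (m + 1) u (x + t • w) fun _ => w)
      (C := (d : ℝ) ^ (m + 1) * ‖w‖ ^ (m + 1) * N) fun t ht => by
        rw [Set.uIoc_of_le zero_le_one] at ht
        rw [norm_smul, Real.norm_eq_abs, Real.norm_eq_abs, abs_pow]
        have h1 : |1 - t| ^ m ≤ 1 := by
          apply pow_le_one₀ (abs_nonneg _)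
          rw [abs_le]; constructor <;> linarith [ht.1, ht.2]
        exact (mul_le_of_le_one_left (abs_nonneg _) h1).trans (hD _ (hsegment t ⟨ht.1.le, ht.2⟩))
    simpa using this
  have hfact : |((m.factorial : ℝ))⁻¹| ≤ 1 := by
    rw [abs_of_nonneg (by positivity)]
    exact inv_le_one_of_one_le₀ (by exact_mod_cast Nat.one_le_iff_ne_zero.2 m.factorial_ne_zero)
  exact (mul_le_of_le_one_left (abs_nonneg _) hfact).trans hint

/-- Multivariate Taylor estimate on the closed ball. -/
theorem abs_sub_taylorPoly_le {d m : ℕ} {x : Pt d} {δ : ℝ} {u : Pt d → ℝ} (hδ : 0 < δ)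
    (hu : ContDiffOn ℝ (m + 1 : ℕ) u (Metric.closedBall x δ)) {y : Pt d}
    (hy : y ∈ Metric.closedBall x δ) :
    |u y - polyFun (taylorPoly m u x) y| ≤
      (d : ℝ) ^ (m + 1) * ‖y - x‖ ^ (m + 1) * cNorm (m + 1) (Metric.closedBall x δ) u := by
  rw [← closure_ball x hδ.ne'] at hy
  have hc : ContinuousOn u (closure (Metric.ball x δ)) := by
    rw [closure_ball x hδ.ne']; exact hu.continuousOn
  refine le_on_closure (f := fun y => |u y - polyFun (taylorPoly m u x) y|)
    (fun z hz => abs_sub_taylorPoly_le_of_mem_ball hu hz) ?_ ?_ hy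
  · exact (hc.sub (contDiff_polyFun _ (n := 0)).continuous.continuousOn).abs
  · exact Continuous.continuousOn (by fun_prop)


/-! ### The least-squares problem -/

/-- `polySpace m x` as a subspace. -/
noncomputable def polySubmodule {d : ℕ} (m : ℕ) (x : Pt d) :
    Submodule ℝ (MvPolynomial (Fin d) ℝ) where
  carrier := polySpace m x
  zero_mem' := ⟨by simp, by simp [polyFun]⟩
  add_mem' := fun {p q} hp hq =>
    ⟨(totalDegree_add p q).trans (max_le hp.1 hq.1), by rw [polyFun_add, hp.2, hq.2, add_zero]⟩
  smul_mem' := fun a p hp =>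
    ⟨(totalDegree_smul_le a p).trans hp.1, by rw [polyFun_smul, hp.2, mul_zero]⟩

/-- With the weights absorbed as square roots, the functional is half a squared distance in `ℝ^M` to
a finite-dimensional, hence complete, subspace, so a nearest point exists. -/
theorem exists_isFit {d : ℕ} (m : ℕ) {Φ : ℝ → ℝ} (x : Pt d) (M : Finset (Pt d)) (u : Pt d → ℝ)
    (hΦ : ∀ s, 0 ≤ s → 0 ≤ Φ s) : ∃ p, IsFit m Φ x M u p := by
  let T : MvPolynomial (Fin d) ℝ →ₗ[ℝ] EuclideanSpace ℝ M :=
    { toFun := fun p => WithLp.toLp 2 fun y => √(Φ ‖x - y‖) * polyFun p y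
      map_add' := fun p q => by ext y; simp [polyFun_add, mul_add]
      map_smul' := fun a p => by ext y; simp [polyFun_smul]; ring }
  let v : EuclideanSpace ℝ M := WithLp.toLp 2 fun y => √(Φ ‖x - y‖) * u y
  have hlsq (p : MvPolynomial (Fin d) ℝ) : lsq Φ x M u p = 1 / 2 * ‖v - T p‖ ^ 2 := by
    rw [lsq, EuclideanSpace.norm_sq_eq, ← Finset.sum_coe_sort M]
    congr 1
    refine Finset.sum_congr rfl fun y _ => ?_
    simp only [v, T, LinearMap.coe_mk, AddHom.coe_mk, PiLp.sub_apply, Real.norm_eq_abs, sq_abs]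
    rw [← mul_sub, mul_pow, Real.sq_sqrt (hΦ _ (norm_nonneg _)), mul_comm]
  obtain ⟨w, hw, hmin⟩ := ((polySubmodule m x).map T).exists_norm_eq_iInf_of_complete_subspace
    (Submodule.complete_of_finiteDimensional _) v
  obtain ⟨p, hp, rfl⟩ := Submodule.mem_map.1 hw
  refine ⟨p, hp, fun q hq => ?_⟩
  rw [hlsq, hlsq]
  have : ‖v - T p‖ ≤ ‖v - T q‖ := by
    rw [hmin]
    exact ciInf_le ⟨0, by rintro _ ⟨_, rfl⟩; exact norm_nonneg _⟩
      (⟨T q, Submodule.mem_map_of_mem hq⟩ : (polySubmodule m x).map T)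
  gcongr

/-- A best fit is close to any other candidate that approximates the data well. -/
theorem IsFit.sum_sq_sub_le {d m : ℕ} {Φ : ℝ → ℝ} {x : Pt d} {M : Finset (Pt d)} {u : Pt d → ℝ}
    {p q : MvPolynomial (Fin d) ℝ} (hΦ : ∀ s, 0 ≤ s → 0 ≤ Φ s) (hp : IsFit m Φ x M u p)
    (hq : q ∈ polySpace m x) :
    ∑ y ∈ M, polyFun (p - q) y ^ 2 * Φ ‖x - y‖ ≤
      4 * ∑ y ∈ M, (u y - polyFun q y) ^ 2 * Φ ‖x - y‖ := by
  have h1 := hp.2 q hq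
  rw [lsq, lsq] at h1
  -- `p - q` is the difference of the residuals of `q` and `p`; each contributes a factor `2`, and
  -- the residual sum of `p` is at most that of `q`.
  have h2 : ∑ y ∈ M, polyFun (p - q) y ^ 2 * Φ ‖x - y‖ ≤
      ∑ y ∈ M, (2 * ((u y - polyFun p y) ^ 2 * Φ ‖x - y‖) +
        2 * ((u y - polyFun q y) ^ 2 * Φ ‖x - y‖)) := by
    refine Finset.sum_le_sum fun y _ => ?_
    rw [polyFun_sub]
    have h3 := hΦ ‖x - y‖ (norm_nonneg _)
    have h4 : (polyFun p y - polyFun q y) ^ 2 ≤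
        2 * (u y - polyFun p y) ^ 2 + 2 * (u y - polyFun q y) ^ 2 := by
      nlinarith [sq_nonneg (2 * u y - polyFun p y - polyFun q y)]
    calc _ ≤ (2 * (u y - polyFun p y) ^ 2 + 2 * (u y - polyFun q y) ^ 2) * Φ ‖x - y‖ := by gcongr
      _ = _ := by ring
  rw [Finset.sum_add_distrib, ← Finset.mul_sum, ← Finset.mul_sum] at h2
  linarith

/-- Two best fits agree on the data points of positive weight. -/
theorem IsFit.polyFun_sub_eq_zero {d m : ℕ} {Φ : ℝ → ℝ} {x : Pt d} {M : Finset (Pt d)}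
    {u : Pt d → ℝ} {p q : MvPolynomial (Fin d) ℝ} (hΦ : ∀ s, 0 ≤ s → 0 ≤ Φ s)
    (hp : IsFit m Φ x M u p) (hq : IsFit m Φ x M u q) {y : Pt d} (hy : y ∈ M)
    (hpos : 0 < Φ ‖x - y‖) : polyFun (p - q) y = 0 := by
  have hmid : (1 / 2 : ℝ) • (p + q) ∈ polySubmodule m x :=
    Submodule.smul_mem _ _ (Submodule.add_mem _ hp.1 hq.1)
  have h1 := hp.2 _ hmid
  have h2 := hq.2 _ hmid
  -- Parallelogram identity: the average of two minimizers would do better unless they agree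
  -- wherever the weight is positive.
  have h3 : lsq Φ x M u ((1 / 2 : ℝ) • (p + q)) = 1 / 2 * lsq Φ x M u p + 1 / 2 * lsq Φ x M u q
      - 1 / 8 * ∑ y ∈ M, polyFun (p - q) y ^ 2 * Φ ‖x - y‖ := by
    simp only [lsq, Finset.mul_sum]
    rw [← Finset.sum_add_distrib, ← Finset.sum_sub_distrib]
    refine Finset.sum_congr rfl fun y _ => ?_
    rw [polyFun_smul, polyFun_add, polyFun_sub]
    ring
  have hterm (z : Pt d) : 0 ≤ polyFun (p - q) z ^ 2 * Φ ‖x - z‖ :=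
    mul_nonneg (sq_nonneg _) (hΦ _ (norm_nonneg _))
  have h4 : ∑ y ∈ M, polyFun (p - q) y ^ 2 * Φ ‖x - y‖ ≤ 0 := by linarith
  have h5 : polyFun (p - q) y ^ 2 * Φ ‖x - y‖ ≤ 0 :=
    (Finset.single_le_sum (f := fun z => polyFun (p - q) z ^ 2 * Φ ‖x - z‖)
      (fun z _ => hterm z) hy).trans h4
  have h6 : polyFun (p - q) y ^ 2 ≤ 0 := nonpos_of_mul_nonpos_left h5 hpos
  exact pow_eq_zero_iff two_ne_zero |>.1 (le_antisymm h6 (sq_nonneg _))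

/-! ### Geometry of the midpoint set -/

/-- A separated set in a ball has boundedly many points. -/
theorem exists_card_le_of_separated (d : ℕ) {η : ℝ} (hη : 0 < η) :
    ∃ N : ℕ, ∀ (x : Pt d) (δ : ℝ) (M : Finset (Pt d)), 0 < δ → (∀ y ∈ M, ‖x - y‖ ≤ δ) →
      (∀ y ∈ M, ∀ z ∈ M, y ≠ z → η * δ ≤ ‖y - z‖) → M.card ≤ N := by
  -- After scaling to the unit ball, each member of a fixed finite cover by balls of radius `η / 2`
  -- holds at most one point.
  obtain ⟨t, -, htfin, ht⟩ := (isCompact_closedBall (0 : Pt d) 1).finite_cover_balls (half_pos hη)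
  refine ⟨htfin.toFinset.card, fun x δ M hδ hM hsep => ?_⟩
  have hex (y : Pt d) (hy : y ∈ M) : ∃ a ∈ t, δ⁻¹ • (y - x) ∈ Metric.ball a (η / 2) := by
    have h1 : δ⁻¹ • (y - x) ∈ Metric.closedBall (0 : Pt d) 1 := by
      rw [mem_closedBall_iff_norm, sub_zero, norm_smul, Real.norm_eq_abs,
        abs_of_pos (inv_pos.2 hδ), inv_mul_le_iff₀ hδ, mul_one, norm_sub_rev]
      exact hM y hy
    simpa using ht h1
  choose! a hat ha using hex
  refine Finset.card_le_card_of_injOn a (fun y hy => by simpa using hat y hy) fun y hy z hz hyz => ?_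
  by_contra hne
  have h1 := hsep y hy z hz hne
  have h2 := ha y hy
  have h3 := ha z hz
  rw [← hyz] at h3
  have h4 : ‖δ⁻¹ • (y - x) - δ⁻¹ • (z - x)‖ < η := by
    rw [← dist_eq_norm]
    calc _ ≤ _ := dist_triangle_right _ _ (a y)
      _ < η / 2 + η / 2 := add_lt_add h2 h3
      _ = η := by ring
  rw [← smul_sub, sub_sub_sub_cancel_right, norm_smul, Real.norm_eq_abs,
    abs_of_pos (inv_pos.2 hδ), inv_mul_lt_iff₀ hδ] at h4
  linarith

theorem two_mul_sepDist_le {d : ℕ} {M : Finset (Pt d)} {y z : Pt d} (hy : y ∈ M) (hz : z ∈ M)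
    (hyz : y ≠ z) : 2 * sepDist M ≤ ‖y - z‖ := by
  have h : sInf {s : ℝ | ∃ x ∈ M, ∃ y ∈ M, x ≠ y ∧ s = ‖x - y‖} ≤ ‖y - z‖ :=
    csInf_le ⟨0, by rintro _ ⟨a, -, b, -, -, rfl⟩; exact norm_nonneg _⟩ ⟨y, hy, z, hz, hyz, rfl⟩
  rw [sepDist]
  linarith

theorem infDist_le_fillDist {d : ℕ} {M : Finset (Pt d)} {Ω : Set (Pt d)} (hΩ : IsCompact Ω)
    {y : Pt d} (hy : y ∈ Ω) : Metric.infDist y (M : Set (Pt d)) ≤ fillDist M Ω :=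
  le_csSup (hΩ.image (Metric.continuous_infDist_pt _)).bddAbove ⟨y, hy, rfl⟩

theorem exists_norm_sub_le_fillDist {d : ℕ} {M : Finset (Pt d)} (hM : M.Nonempty)
    {Ω : Set (Pt d)} (hΩ : IsCompact Ω) {y : Pt d} (hy : y ∈ Ω) :
    ∃ w ∈ M, ‖y - w‖ ≤ fillDist M Ω := by
  obtain ⟨w, hw, hdist⟩ := M.finite_toSet.isCompact.exists_infDist_eq_dist hM y
  exact ⟨w, hw, by rw [← dist_eq_norm, ← hdist]; exact infDist_le_fillDist hΩ hy⟩

theorem notMem_midpoints {d : ℕ} (Ωh : Finset (Pt d)) (x : Pt d) (ε : ℝ) :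
    x ∉ midpoints Ωh x ε := by
  simp only [midpoints, Finset.mem_image, Finset.mem_filter, not_exists, not_and]
  intro y hy hmid
  exact hy.2.1 ((midpoint_eq_left_iff ℝ).1 hmid).symm

/-- Applied to the midpoints, which never contain `x`, this supplies `h > 0`. -/
theorem fillDist_pos {d : ℕ} {M : Finset (Pt d)} (hM : M.Nonempty) {Ω : Set (Pt d)}
    (hΩ : IsCompact Ω) {x : Pt d} (hx : x ∈ Ω) (hxM : x ∉ M) : 0 < fillDist M Ω := by
  refine lt_of_lt_of_le ?_ (infDist_le_fillDist hΩ hx)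
  exact (M.finite_toSet.isClosed.notMem_iff_infDist_pos hM).1 hxM

/-- Near a point of a region with the interior cone condition there is a ball of radius `10 m² h`
in the region. -/
theorem exists_ball_near {d m : ℕ} (hm : 0 < m) {θ r h : ℝ} (hθ : 0 < θ) (hθ' : θ < Real.pi / 2)
    (hh : 0 < h) (hhr : h ≤ r / coneConst m θ) {Ω : Set (Pt d)} (hΩ : InteriorConeCondition Ω θ r)
    {x : Pt d} (hx : x ∈ Ω) :
    ∃ z : Pt d, Metric.closedBall z (10 * (m : ℝ) ^ 2 * h) ⊆ Ω ∧
      x ∈ Metric.closedBall z (1 / Real.sin θ * (10 * (m : ℝ) ^ 2 * h)) ∧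
      ∀ g ∈ Metric.closedBall z (10 * (m : ℝ) ^ 2 * h), ‖x - g‖ ≤ 15 / 16 * coneConst m θ * h := by
  set σ := Real.sin θ with hσ
  have hσ0 : 0 < σ := Real.sin_pos_of_pos_of_lt_pi hθ (by linarith [Real.pi_pos])
  have hσ1 : σ ≤ 1 := Real.sin_le_one θ
  have hm' : (0 : ℝ) < (m : ℝ) ^ 2 := by positivity
  set s : ℝ := 10 * (m : ℝ) ^ 2 * h with hs
  have hs0 : 0 < s := by positivity
  have hCC : coneConst m θ = 16 * (1 + σ) ^ 2 * (m : ℝ) ^ 2 / (3 * σ ^ 2) := rfl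
  have hCC0 : 0 < coneConst m θ := by rw [hCC]; positivity
  -- The difference of the two sides has the sign of `5 (1 + σ) - 10 σ`, nonnegative as `σ ≤ 1`.
  have hR : s / σ + s ≤ 15 / 16 * coneConst m θ * h := by
    have h1 : 15 / 16 * coneConst m θ * h - (s / σ + s) =
        (m : ℝ) ^ 2 * h * (1 + σ) * (5 * (1 + σ) - 10 * σ) / σ ^ 2 := by
      rw [hCC, hs]; field_simp; ring
    have h2 : 0 ≤ (m : ℝ) ^ 2 * h * (1 + σ) * (5 * (1 + σ) - 10 * σ) / σ ^ 2 := by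
      have : 0 ≤ 5 * (1 + σ) - 10 * σ := by linarith
      positivity
    linarith
  obtain ⟨ξ, hξ, hcone⟩ := hΩ x hx
  have hnorm : ‖(s / σ) • ξ‖ = s / σ := by
    rw [norm_smul, hξ, mul_one, Real.norm_eq_abs, abs_of_pos (by positivity)]
  refine ⟨x + (s / σ) • ξ, ?_, ?_, fun g hg => ?_⟩
  · refine (closedBall_subset_cone hξ hs0 hσ0 (R := r) ?_).trans hcone
    rw [le_div_iff₀ hCC0] at hhr
    nlinarith [mul_pos hCC0 hh]
  · rw [mem_closedBall_iff_norm, sub_add_cancel_left, norm_neg, hnorm]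
    apply le_of_eq; ring
  · rw [mem_closedBall_iff_norm] at hg
    calc ‖x - g‖ = ‖(g - (x + (s / σ) • ξ)) + (s / σ) • ξ‖ := by
          rw [norm_sub_rev]; congr 1; abel
      _ ≤ s + s / σ := (norm_add_le _ _).trans (by rw [hnorm]; gcongr)
      _ ≤ _ := by linarith


/-! ### Uniqueness, closeness to the Taylor polynomial, and the final estimate -/

/-- A best fit is determined by its values on a norming set of positive weight. -/
theorem IsFit.eq {d m : ℕ} (hm : 0 < m) {Φ : ℝ → ℝ} {x z : Pt d} {M : Finset (Pt d)}
    {u : Pt d → ℝ} {p q : MvPolynomial (Fin d) ℝ} {h s : ℝ} (hΦ : ∀ s, 0 ≤ s → 0 ≤ Φ s)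
    (hp : IsFit m Φ x M u p) (hq : IsFit m Φ x M u q)
    (hh : 0 < h) (hs : s = 10 * (m : ℝ) ^ 2 * h)
    (hM : ∀ y ∈ Metric.closedBall z s, ∃ w ∈ M, ‖y - w‖ ≤ h)
    (hpos : ∀ y ∈ Metric.closedBall z s, 0 < Φ ‖x - y‖) : p = q := by
  have hs0 : 0 < s := by rw [hs]; positivity
  have hdeg : (p - q).totalDegree ≤ m := ((polySubmodule m x).sub_mem hp.1 hq.1).1
  refine sub_eq_zero.1 (eq_zero_of_polyFun_eq_zero_on_ball (z := z) hs0 fun y hy => ?_)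
  have := norming_on_ball hm hdeg hh hs hM (A := 0) (fun w hwM hw => by
    rw [IsFit.polyFun_sub_eq_zero hΦ hp hq hwM (hpos w hw), abs_zero]) y hy
  rw [mul_zero] at this
  exact abs_eq_zero.1 (le_antisymm this (abs_nonneg _))

/-- If `u` is `E`-close to `q` on the data points of nonzero weight, then the best fit is close to
`q` on a ball for which the data points are a norming set. -/
theorem IsFit.abs_polyFun_sub_le {d m N : ℕ} (hm : 0 < m) {Φ : ℝ → ℝ} {x z : Pt d}
    {M : Finset (Pt d)} {u : Pt d → ℝ} {p q : MvPolynomial (Fin d) ℝ} {h s δ κ K E : ℝ}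
    (hΦ : ∀ s, 0 ≤ s → 0 ≤ Φ s) (hΦK : ∀ s, 0 ≤ s → Φ s ≤ K) (hΦδ : ∀ s, δ < s → Φ s = 0)
    (hp : IsFit m Φ x M u p) (hq : q ∈ polySpace m x)
    (hh : 0 < h) (hs : s = 10 * (m : ℝ) ^ 2 * h)
    (hM : ∀ y ∈ Metric.closedBall z s, ∃ w ∈ M, ‖y - w‖ ≤ h)
    (hκ : 0 < κ) (hκΦ : ∀ y ∈ Metric.closedBall z s, κ ≤ Φ ‖x - y‖)
    (hN : (M.filter fun y => ‖x - y‖ ≤ δ).card ≤ N)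
    (hE0 : 0 ≤ E) (hE : ∀ y ∈ Metric.closedBall x δ, |u y - polyFun q y| ≤ E) :
    ∀ y ∈ Metric.closedBall z s, |polyFun (p - q) y| ≤ 3 * (√(4 * N * K / κ) * E) := by
  have hdeg : (p - q).totalDegree ≤ m := ((polySubmodule m x).sub_mem hp.1 hq).1
  have hK0 : 0 ≤ K := (hΦ 0 le_rfl).trans (hΦK 0 le_rfl)
  have hsum : ∑ y ∈ M, (u y - polyFun q y) ^ 2 * Φ ‖x - y‖ ≤ N * (E ^ 2 * K) := by
    have hterm : ∀ y ∈ M.filter fun y => ‖x - y‖ ≤ δ,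
        (u y - polyFun q y) ^ 2 * Φ ‖x - y‖ ≤ E ^ 2 * K := by
      intro y hy
      have hy' : y ∈ Metric.closedBall x δ := by
        rw [mem_closedBall_iff_norm, norm_sub_rev]; exact (Finset.mem_filter.1 hy).2
      have h1 : (u y - polyFun q y) ^ 2 ≤ E ^ 2 := sq_le_sq' (abs_le.1 (hE y hy')).1
        (abs_le.1 (hE y hy')).2
      exact mul_le_mul h1 (hΦK _ (norm_nonneg _)) (hΦ _ (norm_nonneg _)) (sq_nonneg _)
    -- Points farther than `δ` carry no weight, so at most `N` terms remain.
    rw [← Finset.sum_filter_add_sum_filter_not M (fun y => ‖x - y‖ ≤ δ),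
      Finset.sum_eq_zero (s := M.filter fun y => ¬ ‖x - y‖ ≤ δ) (fun y hy => by
        rw [hΦδ _ (not_le.1 (Finset.mem_filter.1 hy).2), mul_zero]), add_zero]
    refine (Finset.sum_le_card_nsmul _ _ _ hterm).trans ?_
    rw [nsmul_eq_mul]
    have : ((M.filter fun y => ‖x - y‖ ≤ δ).card : ℝ) ≤ N := by exact_mod_cast hN
    gcongr
  refine norming_on_ball hm hdeg hh hs hM fun w hwM hw => ?_
  have h1 : polyFun (p - q) w ^ 2 * κ ≤ 4 * (N * (E ^ 2 * K)) := by
    calc polyFun (p - q) w ^ 2 * κ ≤ polyFun (p - q) w ^ 2 * Φ ‖x - w‖ := by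
          gcongr
          exact hκΦ w hw
      _ ≤ ∑ y ∈ M, polyFun (p - q) y ^ 2 * Φ ‖x - y‖ :=
          Finset.single_le_sum (f := fun y => polyFun (p - q) y ^ 2 * Φ ‖x - y‖)
            (fun y _ => mul_nonneg (sq_nonneg _) (hΦ _ (norm_nonneg _))) hwM
      _ ≤ 4 * ∑ y ∈ M, (u y - polyFun q y) ^ 2 * Φ ‖x - y‖ := hp.sum_sq_sub_le hΦ hq
      _ ≤ _ := by linarith
  apply abs_le_of_sq_le_sq _ (by positivity)
  rw [mul_pow, Real.sq_sqrt (by positivity), div_mul_eq_mul_div, le_div_iff₀ hκ]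
  linarith

theorem gmlsDeriv_eq {d m : ℕ} {Φ : ℝ → ℝ} {x : Pt d} {M : Finset (Pt d)} {α : Fin d → ℕ}
    {u : Pt d → ℝ} (h : ∃! p, IsFit m Φ x M u p) {p : MvPolynomial (Fin d) ℝ}
    (hp : IsFit m Φ x M u p) : gmlsDeriv m Φ x M α u = partialD α (polyFun p) x := by
  rw [gmlsDeriv, dif_pos ⟨p, hp⟩, h.unique (Exists.choose_spec ⟨p, hp⟩) hp]

end GMLS


theorem lemma3p3 (d m : ℕ) (hm : 0 < m) (θ r c : ℝ) (hθ : 0 < θ) (hθ' : θ < Real.pi / 2)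
    (hr : 0 < r) (hc : 0 < c) (φ : ℝ → ℝ) (hφ : GMLS.IsWeightProfile φ)
    (α : Fin d → ℕ) (hα : ∑ i, α i ≤ m + 1) :
    ∃ C : ℝ, 0 < C ∧
      ∀ (Ω : Set (GMLS.Pt d)) (Ωh : Finset (GMLS.Pt d)) (x : GMLS.Pt d) (ε : ℝ)
        (M : Finset (GMLS.Pt d)) (h δ : ℝ) (Φ : ℝ → ℝ) (u : GMLS.Pt d → ℝ),
        IsCompact Ω → GMLS.InteriorConeCondition Ω θ r →
        0 < ε → x ∈ Ωh → x ∈ Ω →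
        M = GMLS.midpoints Ωh x ε → M.Nonempty → (M : Set (GMLS.Pt d)) ⊆ Ω →
        h = GMLS.fillDist M Ω → GMLS.QuasiUniform c M Ω → h ≤ r / GMLS.coneConst m θ →
        δ = 2 * GMLS.coneConst m θ * h → Φ = (fun s => φ (s / δ)) →
        ContDiffOn ℝ ((m + 1 : ℕ) : WithTop ℕ∞) u (Metric.closedBall x δ) → u x = 0 →
        (∃! p, GMLS.IsFit m Φ x M u p) ∧
          |GMLS.gmlsDeriv m Φ x M α u - GMLS.partialD α u x| ≤
            C * h ^ (m + 1 - ∑ i, α i) * GMLS.cNorm (m + 1) (Metric.closedBall x δ) u := by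
  open GMLS in
  set CC := coneConst m θ with hCC
  have hσ : 0 < Real.sin θ := Real.sin_pos_of_pos_of_lt_pi hθ (by linarith [Real.pi_pos])
  have hCC0 : 0 < CC := by rw [hCC, coneConst]; positivity
  -- The norming ball lies within `(15/16) CC h = (15/32) δ` of `x`, strictly inside the range `1/2`
  -- where the profile is bounded below.
  obtain ⟨κ, hκ, hκφ⟩ := hφ.pos (15 / 32) (by norm_num)
  obtain ⟨K, hK⟩ := hφ.bounded
  have hK0 : 0 ≤ K := (hφ.nonneg 0 le_rfl).trans (hK 0 le_rfl)
  -- With `δ = 2 CC h`, this `η` gives `η δ = 2 h / c`, at most twice the separation distance.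
  obtain ⟨N, hN⟩ := exists_card_le_of_separated d (η := 1 / (c * CC)) (by positivity)
  obtain ⟨C₁, hC₁, hderiv⟩ := exists_partialD_bound d m α (1 / Real.sin θ)
  set B : ℝ := C₁ * (3 * (√(4 * N * K / κ) * ((d : ℝ) ^ (m + 1) * (2 * CC) ^ (m + 1)))) with hB
  have hB0 : 0 ≤ B := by positivity
  -- The summand `1` ensures positivity and covers the top order `|α| = m + 1`.
  refine ⟨B + 1, by linarith, ?_⟩
  intro Ω Ωh x ε M h δ Φ u hΩ hcone hε hxΩh hxΩ hMdef hMne hMΩ hh hqu hhr hδ hΦ hu hux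
  have hh0 : 0 < h := by
    rw [hh]
    exact fillDist_pos hMne hΩ hxΩ (hMdef ▸ notMem_midpoints Ωh x ε)
  have hδ0 : 0 < δ := by rw [hδ]; positivity
  obtain ⟨z, hzΩ, hxz, hzx⟩ := exists_ball_near hm hθ hθ' hh0 hhr hcone hxΩ
  obtain ⟨s, hs⟩ : ∃ s : ℝ, s = 10 * (m : ℝ) ^ 2 * h := ⟨_, rfl⟩
  rw [← hs] at hzΩ hxz hzx
  have hhs : h ≤ s := by
    have : (1 : ℝ) ≤ (m : ℝ) ^ 2 := one_le_pow₀ (by exact_mod_cast hm)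
    rw [hs]; nlinarith
  have hΦ0 (t : ℝ) (ht : 0 ≤ t) : 0 ≤ Φ t := by
    rw [hΦ]; exact hφ.nonneg _ (by positivity)
  have hΦK (t : ℝ) (ht : 0 ≤ t) : Φ t ≤ K := by
    rw [hΦ]; exact hK _ (by positivity)
  have hΦδ (t : ℝ) (ht : δ < t) : Φ t = 0 := by
    rw [hΦ]; exact hφ.support _ ((one_lt_div hδ0).2 ht)
  have hκΦ (y : Pt d) (hy : y ∈ Metric.closedBall z s) : κ ≤ Φ ‖x - y‖ := by
    rw [hΦ]
    refine hκφ _ (by positivity) ((div_le_iff₀ hδ0).2 ((hzx y hy).trans (le_of_eq ?_)))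
    rw [hδ]; ring
  have hMdense (y : Pt d) (hy : y ∈ Metric.closedBall z s) : ∃ w ∈ M, ‖y - w‖ ≤ h := by
    rw [hh]; exact exists_norm_sub_le_fillDist hMne hΩ (hzΩ hy)
  have hcard : (M.filter fun y => ‖x - y‖ ≤ δ).card ≤ N := by
    refine hN x δ _ hδ0 (fun y hy => (Finset.mem_filter.1 hy).2) fun y hy w hw hyw => ?_
    refine le_trans ?_ (two_mul_sepDist_le (Finset.mem_filter.1 hy).1 (Finset.mem_filter.1 hw).1 hyw)
    have h1 : h ≤ c * sepDist M := hh ▸ hqu.2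
    rw [hδ, div_mul_eq_mul_div, div_le_iff₀ (by positivity)]
    nlinarith
  obtain ⟨p, hp⟩ := exists_isFit m x M u hΦ0
  have hunique : ∃! p, IsFit m Φ x M u p := ⟨p, hp, fun q hq =>
    IsFit.eq hm hΦ0 hq hp hh0 hs hMdense fun y hy => hκ.trans_le (hκΦ y hy)⟩
  refine ⟨hunique, ?_⟩
  rw [gmlsDeriv_eq hunique hp]
  set n := cNorm (m + 1) (Metric.closedBall x δ) u with hn
  have hn0 : 0 ≤ n := cNorm_nonneg _ _ _
  -- In the first case `|α| = m + 1`: the fit contributes nothing, the power of `h` is `h ^ 0`, and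
  -- the norm of `u` alone is the bound.
  rcases Nat.lt_or_ge m (∑ i, α i) with hlt | hle
  · rw [partialD_polyFun_eq_zero α p (hp.1.1.trans_lt hlt), zero_sub, abs_neg,
      Nat.sub_eq_zero_of_le hlt, pow_zero, mul_one]
    refine (abs_partialD_le_cNorm hδ0 hu α hα (Metric.mem_ball_self hδ0)).trans ?_
    exact le_mul_of_one_le_left hn0 (by linarith)
  · set t := taylorPoly m u x with ht
    have htmem : t ∈ polySpace m x :=
      ⟨totalDegree_taylorPoly_le m u x, by rw [ht, polyFun_taylorPoly_self, hux]⟩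
    have hux' : ContDiffAt ℝ m u x :=
      (hu.contDiffAt (Metric.closedBall_mem_nhds x hδ0)).of_le (by exact_mod_cast Nat.le_succ m)
    have hE (y : Pt d) (hy : y ∈ Metric.closedBall x δ) :
        |u y - polyFun t y| ≤ (d : ℝ) ^ (m + 1) * δ ^ (m + 1) * n := by
      refine (abs_sub_taylorPoly_le hδ0 hu hy).trans ?_
      have := mem_closedBall_iff_norm.1 hy
      gcongr
    have hclose := IsFit.abs_polyFun_sub_le hm hΦ0 hΦK hΦδ hp htmem hh0 hs hMdense hκ hκΦ hcard
      (by positivity) hE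
    have hdeg : (p - t).totalDegree ≤ m := ((polySubmodule m x).sub_mem hp.1 htmem).1
    have h1 := hderiv (p - t) hdeg _ s z (by linarith) hclose x hxz
    rw [partialD_polyFun_sub, ht, partialD_taylorPoly hux' α hle] at h1
    set D := |partialD α (polyFun p) x - partialD α u x|
    -- Since `h ≤ s`, the scale factor may be lowered to `h ^ |α|`, which then cancels against `h ^
    -- (m + 1)`.
    have h2 : h ^ (∑ i, α i) * D ≤ h ^ (∑ i, α i) * (B * h ^ (m + 1 - ∑ i, α i) * n) := by
      calc h ^ (∑ i, α i) * D ≤ s ^ (∑ i, α i) * D := by gcongr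
        _ ≤ _ := h1
        _ = B * h ^ (m + 1) * n := by rw [hB, hδ, mul_pow]; ring
        _ = _ := by
          rw [← Nat.add_sub_cancel' hα, pow_add, Nat.add_sub_cancel' hα]; ring
    have h3 := le_of_mul_le_mul_left h2 (by positivity)
    refine h3.trans ?_
    gcongr
    linarith
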